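/- Let $\mathcal{C}$ be a model category, let $X$ be a cofibrant object of $\mathcal{C}$ and let $Y$ be any object of $\mathcal{C}$. For an object $X$ let $\ell^\bullet X$ be the cosimplicial object with $(\ell^\bullet X)[n]=\coprod_{i=0}^{n}X$ (one copy for each vertex of $[n]$, with the structure maps induced by the action on vertices), let $r^\bullet X$ be the constant cosimplicial object with value $X$, and let $\ell^\bullet X\to r^\bullet X$ be the map given in each degree by the fold map. A map $A^\bullet\to B^\bullet$ of cosimplicial objects is a Reedy cofibration if for every $n\ge 0$ the map $L_nB\sqcup_{L_nA}A^\bullet[n]\to B^\bullet[n]$ is a cofibration, where the latching object $L_nA$ is the colimit of $A^\bullet[k]$ over the injections $[k]\hookrightarrow[n]$ with $k<n$. A cosimplicial frame for $X$ is a cosimplicial object $X^\bullet$ together with a factorisation $$\ell^\bullet X\longrightarrow X^\bullet\longrightarrow r^\bullet X$$ of the canonical map into a Reedy cofibration followed by a levelwise weak equivalence. A fibrant replacement of $Y$ is a factorisation $Y\to Y^{\mathrm{fib}}\to *$ of the map to the terminal object into a cofibration that is a weak equivalence, followed by a fibration. For such data, $\mathcal{C}(X^\bullet,Y^{\mathrm{fib}})$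 denotes the simplicial set with $n$-simplices $\mathrm{Hom}_{\mathcal{C}}(X^\bullet[n],Y^{\mathrm{fib}})$. Let $X_1^\bullet, X_2^\bullet$ be two cosimplicial frames for $X$ and let $Y_1^{\mathrm{fib}}, Y_2^{\mathrm{fib}}$ be two fibrant replacements of $Y$. Then $$\mathcal{C}(X_1^\bullet,Y_1^{\mathrm{fib}})\simeq\mathcal{C}(X_2^\bullet,Y_2^{\mathrm{fib}}),$$ that is, these two simplicial sets are connected by a finite zigzag of weak equivalences of simplicial sets. (A map $f:A\to B$ of simplicial sets is a weak equivalence if for every Kan complex $K$ it induces a bijection $[B,K]\to[A,K]$ on simplicial homotopy classes of maps.) -/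

import Mathlib

open CategoryTheory Limits HomotopicalAlgebra Opposite MonoidalCategory Simplicial

universe v u

noncomputable section

namespace Framings

/-! ### Weak equivalences of simplicial sets -/

/-- The set `[X, K]` of homotopy classes of maps `X ⟶ K`: the quotient of `X ⟶ K` by the
equivalence relation generated by simplicial homotopy `X ⊗ Δ[1] ⟶ K`. This is the set of
connected components of the simplicial mapping space `K ^ X`. -/
def HomotopyClasses (X K : SSet.{v}) : Type v :=
  Quot (fun f g : X ⟶ K ↦ Nonempty (SSet.Homotopy f g))

/-- Homotopies can be precomposed with a map. -/
lemma nonempty_homotopy_precomp {X Y K : SSet.{v}} (f : X ⟶ Y) {g h : Y ⟶ K}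
    (H : Nonempty (SSet.Homotopy g h)) : Nonempty (SSet.Homotopy (f ≫ g) (f ≫ h)) := by
  obtain ⟨H⟩ := H
  refine ⟨{ h := f ▷ Δ[1] ≫ H.h, h₀ := ?_, h₁ := ?_, rel := ?_ }⟩
  · exact (SSet.ι₀_comp_assoc f H.h).trans (congrArg (f ≫ ·) H.h₀)
  · exact (SSet.ι₁_comp_assoc f H.h).trans (congrArg (f ≫ ·) H.h₁)
  · ext n ⟨x, _⟩
    exact x.2.elim

/-- The map `[Y, K] → [X, K]` induced by `f : X ⟶ Y`. -/
def HomotopyClasses.precomp {X Y : SSet.{v}} (f : X ⟶ Y) (K : SSet.{v}) :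
    HomotopyClasses Y K → HomotopyClasses X K :=
  Quot.map (fun g ↦ f ≫ g) (fun _ _ H ↦ nonempty_homotopy_precomp f H)

/-- A map `f : X ⟶ Y` of simplicial sets is a weak (homotopy) equivalence if, for every Kan
complex `K`, precomposition with `f` is a bijection `[Y, K] → [X, K]`. -/
def IsWeakEquivalence {X Y : SSet.{v}} (f : X ⟶ Y) : Prop :=
  ∀ (K : SSet.{v}), SSet.KanComplex K → Function.Bijective (HomotopyClasses.precomp f K)

/-- Two simplicial sets are weakly equivalent if they are connected by a finite zigzag of
weak equivalences. -/
def WeaklyEquivalent (X Y : SSet.{v}) : Prop :=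
  Relation.EqvGen (fun A B : SSet.{v} ↦ ∃ f : A ⟶ B, IsWeakEquivalence f) X Y

/-! ### Latching objects and Reedy cofibrations of cosimplicial objects -/

/-- The injective maps `⦋k⦌ ⟶ n` with `k < n`, as a property of objects over `n`. -/
def latchingProperty (n : SimplexCategory) : ObjectProperty (Over n) :=
  fun A ↦ Mono A.hom ∧ A.left.len < n.len

/-- The latching category of the simplex category at `n`: its objects are the injective maps
`⦋k⦌ ⟶ n` with `k < n`, and its morphisms are the (automatically injective) maps over `n`. -/
abbrev LatchingCategory (n : SimplexCategory) : Type :=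
  (latchingProperty n).FullSubcategory

instance (n : SimplexCategory) : Finite (LatchingCategory n) := by
  let φ : LatchingCategory n → Σ k : Fin n.len, (⦋(k : ℕ)⦌ ⟶ n) :=
    fun A ↦ ⟨⟨A.obj.left.len, A.property.2⟩, A.obj.hom⟩
  refine Finite.of_injective φ ?_
  rintro ⟨⟨k, ⟨⟨⟩⟩, f⟩, hf⟩ ⟨⟨l, ⟨⟨⟩⟩, g⟩, hg⟩ h
  induction k using SimplexCategory.rec with | _ k
  induction l using SimplexCategory.rec with | _ l
  simp only [φ, Sigma.mk.injEq, Fin.mk.injEq] at h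
  obtain ⟨h₁, h₂⟩ := h
  change k = l at h₁
  subst h₁
  obtain rfl := eq_of_heq h₂
  rfl

instance (n : SimplexCategory) (A B : LatchingCategory n) : Finite (A ⟶ B) :=
  Finite.of_injective (fun f ↦ f.hom.left) (fun f g h ↦ by
    ext1
    exact Over.OverMorphism.ext h)

instance (n : SimplexCategory) : FinCategory (LatchingCategory n) where
  fintypeObj := Fintype.ofFinite _
  fintypeHom _ _ := Fintype.ofFinite _

section Latching

variable {C : Type u} [Category.{v} C] [HasFiniteColimits C]

/-- The diagram `([k] ↪ [n]) ↦ X[k]` whose colimit is the latching object. -/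
abbrev latchingDiagram (X : SimplexCategory ⥤ C) (n : SimplexCategory) :
    LatchingCategory n ⥤ C :=
  ((latchingProperty n).ι ⋙ Over.forget n) ⋙ X

/-- The latching object `L_n X`: the colimit of `X[k]` over the injections `[k] ↪ [n]`
with `k < n`. -/
def latchingObj (X : SimplexCategory ⥤ C) (n : SimplexCategory) : C :=
  colimit (latchingDiagram X n)

/-- The canonical map `L_n X ⟶ X[n]`. -/
def latchingMap (X : SimplexCategory ⥤ C) (n : SimplexCategory) :
    latchingObj X n ⟶ X.obj n :=
  colimit.desc (latchingDiagram X n)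
    { pt := X.obj n
      ι :=
        { app := fun A ↦ X.map A.obj.hom
          naturality := fun A B f ↦ by
            simp [← X.map_comp] } }

/-- The map `L_n X ⟶ L_n Y` induced by a map of cosimplicial objects. -/
def latchingObjMap {X Y : SimplexCategory ⥤ C} (f : X ⟶ Y) (n : SimplexCategory) :
    latchingObj X n ⟶ latchingObj Y n :=
  colimMap (Functor.whiskerLeft ((latchingProperty n).ι ⋙ Over.forget n) f)

lemma latchingObjMap_comp_latchingMap {X Y : SimplexCategory ⥤ C} (f : X ⟶ Y)
    (n : SimplexCategory) :
    latchingObjMap f n ≫ latchingMap Y n = latchingMap X n ≫ f.app n := by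
  dsimp only [latchingObjMap, latchingMap, latchingObj]
  refine colimit.hom_ext (fun A ↦ ?_)
  rw [ι_colimMap_assoc, colimit.ι_desc, colimit.ι_desc_assoc]
  exact (f.naturality A.obj.hom).symm

/-- The relative latching map `L_n Y ⊔_{L_n X} X[n] ⟶ Y[n]` of `f : X ⟶ Y`. -/
def relativeLatchingMap {X Y : SimplexCategory ⥤ C} (f : X ⟶ Y) (n : SimplexCategory) :
    pushout (latchingObjMap f n) (latchingMap X n) ⟶ Y.obj n :=
  pushout.desc (latchingMap Y n) (f.app n) (latchingObjMap_comp_latchingMap f n)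

/-- A map of cosimplicial objects is a Reedy cofibration if all its relative latching maps
are cofibrations. -/
def IsReedyCofibration [CategoryWithCofibrations C] {X Y : SimplexCategory ⥤ C}
    (f : X ⟶ Y) : Prop :=
  ∀ n : SimplexCategory, Cofibration (relativeLatchingMap f n)

/-! ### The cosimplicial objects `ℓ•X` and `r•X`, and cosimplicial frames -/

/-- The cosimplicial object `ℓ•X`: in degree `n` it is the coproduct of `n + 1` copies of `X`,
indexed by the vertices of `[n]`, and a map `[n] ⟶ [m]` acts through its effect on vertices. -/
def lObj (X : C) : SimplexCategory ⥤ C where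
  obj n := ∐ fun _ : Fin (n.len + 1) ↦ X
  map θ := Sigma.map' (SimplexCategory.Hom.toOrderHom θ) (fun _ ↦ 𝟙 X)
  map_id n := by
    apply Sigma.hom_ext
    intro i
    simp
  map_comp θ η := by
    apply Sigma.hom_ext
    intro i
    simp

/-- The cosimplicial object `r•X`, which is constant with value `X`. -/
abbrev rObj (X : C) : SimplexCategory ⥤ C :=
  (Functor.const SimplexCategory).obj X

/-- The canonical map `ℓ•X ⟶ r•X`, given by the fold maps (in degree zero, the identity
of `X`). -/
def foldMap (X : C) : lObj X ⟶ rObj X where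
  app n := Sigma.desc (fun _ : Fin (n.len + 1) ↦ 𝟙 X)
  naturality n m θ := by
    apply Sigma.hom_ext
    intro i
    simp [lObj]

end Latching

section ModelCategory

variable {C : Type u} [Category.{v} C] [ModelCategory C]

/-- A cosimplicial frame on `X`: a cosimplicial object `X•` with a factorization
`ℓ•X ⟶ X• ⟶ r•X` of the canonical map as a Reedy cofibration followed by a
(levelwise, in particular in degree zero) weak equivalence. -/
structure CosimplicialFrame (X : C) where
  /-- the underlying cosimplicial object -/
  obj : SimplexCategory ⥤ C
  /-- the map from `ℓ•X` -/
  ι : lObj X ⟶ obj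
  /-- the map to `r•X` -/
  π : obj ⟶ rObj X
  fac : ι ≫ π = foldMap X
  isReedyCofibration_ι : IsReedyCofibration ι
  weakEquivalence_π : ∀ n : SimplexCategory, WeakEquivalence (π.app n)

/-- A fibrant replacement of `Y`: a factorization of `Y ⟶ *` as a trivial cofibration
`Y ⟶ Y^fib` followed by a fibration `Y^fib ⟶ *`. -/
structure FibrantReplacement (Y : C) where
  /-- the fibrant object -/
  obj : C
  /-- the map from `Y` -/
  ι : Y ⟶ obj
  cofibration_ι : Cofibration ι
  weakEquivalence_ι : WeakEquivalence ι
  isFibrant : IsFibrant obj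

end ModelCategory

/-- The simplicial set `C(X•, Y)` with `n`-simplices the maps `X•[n] ⟶ Y`. -/
def mappingSpace {C : Type u} [Category.{v} C] (X : SimplexCategory ⥤ C) (Y : C) : SSet.{v} :=
  X.op ⋙ yoneda.obj Y

end Framings

end

noncomputable section

namespace Framings

/-! ### Trivial fibrations of simplicial sets are weak equivalences -/

/-! Every map in the zigzag is a trivial fibration of simplicial sets, that is, has the right
lifting property against all ∂Δ[n] → Δ[n]. Such a map has a section which is also a homotopy
inverse, so it is a weak equivalence (`isWeakEquivalence_of_rlp`). Since a map ∂Δ[n] → C(A, Z) is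
the same as a map L_n A → Z, the lifting property for mapping spaces becomes a lifting property of
latching maps in C.

Target variable: factoring Y → Y₁ × Y₂ as a trivial cofibration followed by a fibration gives an
object T with trivial fibrations to Y₁ and Y₂. Because X is cofibrant, a frame on X is Reedy
cofibrant, so C(X₁, T) → C(X₁, Yᵢ) is a trivial fibration.

Cosimplicial variable: the pushout P of the two frames over ℓX receives Reedy cofibrations from
both, but these are known to be weak equivalences only in degree zero. By
`exists_isReedyCofibration_matchingLifts` there is a Reedy cofibration P → W, an isomorphism in
degree zero, such that the matching maps of W in positive degrees are trivial fibrations. Then every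
W[n] → W[0] is a weak equivalence, so both frames map to W by Reedy cofibrations that are levelwise
weak equivalences. The relative latching maps of these are trivial cofibrations
(`weakEquivalence_relativeLatchingMap`), hence C(W, Z) → C(Xᵢ, Z) is a trivial fibration for fibrant
Z. -/

/-- The two end inclusions of the cylinder, as a map from an explicit coproduct. -/
def cylinderEnds (E : SSet.{v}) : (FunctorToTypes.coprod E E : SSet.{v}) ⟶ E ⊗ Δ[1] :=
  FunctorToTypes.coprod.desc SSet.ι₀ SSet.ι₁

/-- The two ends are disjoint because the Δ[1]-coordinate of a simplex takes different values on
them, already at its vertex 0. -/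
instance (E : SSet.{v}) : Mono (cylinderEnds E) := by
  rw [NatTrans.mono_iff_mono_app]
  intro ⟨⟨m⟩⟩
  rw [CategoryTheory.mono_iff_injective]
  rintro (x | x) (y | y) h
  · exact congrArg Sum.inl (congrArg Prod.fst h)
  · have h' : ((SSet.ι₀.app _ x).2 : Δ[1] _⦋m⦌) (0 : Fin (m + 1)) = (SSet.ι₁.app _ y).2 0 :=
      congrArg (fun z : Δ[1] _⦋m⦌ ↦ z 0) (congrArg Prod.snd h)
    simp at h'
  · have h' : ((SSet.ι₁.app _ x).2 : Δ[1] _⦋m⦌) (0 : Fin (m + 1)) = (SSet.ι₀.app _ y).2 0 :=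
      congrArg (fun z : Δ[1] _⦋m⦌ ↦ z 0) (congrArg Prod.snd h)
    simp at h'
  · exact congrArg Sum.inr (congrArg Prod.fst h)

/-- A map with the right lifting property against the boundary inclusions is a weak equivalence. -/
theorem isWeakEquivalence_of_rlp {E B : SSet.{v}} (p : E ⟶ B)
    (hp : SSet.modelCategoryQuillen.I.rlp p) : IsWeakEquivalence p := by
  rw [← SSet.rlp_monomorphisms] at hp
  obtain ⟨s, hs⟩ : ∃ s : B ⟶ E, s ≫ p = 𝟙 B := by
    have := hp _ (MorphismProperty.monomorphisms.infer_property (⊥ : B.Subcomplex).ι)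
    have sq : CommSq (SSet.Subcomplex.isInitialBot.to E) (⊥ : B.Subcomplex).ι p (𝟙 B) :=
      ⟨SSet.Subcomplex.isInitialBot.hom_ext _ _⟩
    exact ⟨sq.lift, sq.fac_right⟩
  -- Lifting against the inclusion of the two ends of the cylinder, over the homotopy that is
  -- constant at `p`, joins `p ≫ s` to the identity.
  obtain ⟨H⟩ : Nonempty (SSet.Homotopy (p ≫ s) (𝟙 E)) := by
    have := hp _ (MorphismProperty.monomorphisms.infer_property (cylinderEnds E))
    have sq : CommSq (FunctorToTypes.coprod.desc (p ≫ s) (𝟙 E)) (cylinderEnds E) p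
        (CartesianMonoidalCategory.fst E Δ[1] ≫ p) := ⟨by
      refine NatTrans.ext (funext fun m ↦ ?_)
      ext (x | x)
      · exact ConcreteCategory.congr_hom (congr_app hs m) (p.app m x)
      · rfl⟩
    refine ⟨{ h := sq.lift, h₀ := ?_, h₁ := ?_, rel := ?_ }⟩
    · exact congrArg (FunctorToTypes.coprod.inl ≫ ·) sq.fac_left
    · exact congrArg (FunctorToTypes.coprod.inr ≫ ·) sq.fac_left
    -- The homotopy is relative to the empty subcomplex, so this condition is vacuous.
    · ext n ⟨x, _⟩
      exact x.2.elim
  intro K _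
  have precomp_precomp {X Y Z : SSet.{v}} (f : X ⟶ Y) (g : Y ⟶ Z) (x : HomotopyClasses Z K) :
      HomotopyClasses.precomp f K (HomotopyClasses.precomp g K x) =
        HomotopyClasses.precomp (f ≫ g) K x := by
    obtain ⟨h, rfl⟩ := Quot.exists_rep x
    exact congrArg (Quot.mk _) (Category.assoc f g h).symm
  have precomp_id {X : SSet.{v}} (x : HomotopyClasses X K) :
      HomotopyClasses.precomp (𝟙 X) K x = x := by
    obtain ⟨h, rfl⟩ := Quot.exists_rep x
    exact congrArg (Quot.mk _) (Category.id_comp h)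
  refine Function.bijective_iff_has_inverse.2
    ⟨HomotopyClasses.precomp s K, fun x ↦ ?_, fun x ↦ ?_⟩
  · rw [precomp_precomp, hs, precomp_id]
  · rw [precomp_precomp]
    obtain ⟨h, rfl⟩ := Quot.exists_rep x
    refine Quot.sound ?_
    refine ⟨{ h := H.h ≫ h, h₀ := ?_, h₁ := ?_, rel := ?_ }⟩
    · exact congrArg (· ≫ h) H.h₀
    · exact (congrArg (· ≫ h) H.h₁).trans (Category.id_comp h)
    · ext n ⟨x, _⟩
      exact x.2.elim

/-! ### Lifting properties of mapping spaces -/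

section

variable {C : Type u} [Category.{v} C]

/-- The map of mapping spaces induced by a map of cosimplicial objects. -/
def mappingSpaceMapLeft {A B : SimplexCategory ⥤ C} (f : A ⟶ B) (Z : C) :
    mappingSpace B Z ⟶ mappingSpace A Z :=
  Functor.whiskerRight (NatTrans.op f) (yoneda.obj Z)

/-- The map of mapping spaces induced by a map of target objects. -/
def mappingSpaceMapRight (A : SimplexCategory ⥤ C) {Z T : C} (q : Z ⟶ T) :
    mappingSpace A Z ⟶ mappingSpace A T :=
  Functor.whiskerLeft A.op (yoneda.map q)

/-- The map that corresponds to a simplex of the mapping space. -/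
def homOfSimplex {A : SimplexCategory ⥤ C} {Z : C} {n : ℕ}
    (t : (Δ[n] : SSet.{v}) ⟶ mappingSpace A Z) : A.obj ⦋n⦌ ⟶ Z :=
  SSet.yonedaEquiv t

lemma map_homOfSimplex {A : SimplexCategory ⥤ C} {Z : C} {n : ℕ}
    (t : (Δ[n] : SSet.{v}) ⟶ mappingSpace A Z) {m : SimplexCategory}
    (g : m ⟶ ⦋n⦌) :
    A.map g ≫ homOfSimplex t = t.app (op m) (SSet.stdSimplex.objEquiv.symm g) := by
  have := ConcreteCategory.congr_hom (t.naturality g.op) (SSet.stdSimplex.objEquiv.symm (𝟙 _))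
  refine this.symm.trans (congrArg (t.app (op m)) ?_)
  exact congrArg SSet.stdSimplex.objEquiv.symm (Category.comp_id g)

lemma mem_boundary_of_len_lt {n : ℕ} {m : SimplexCategory} (h : m.len < n)
    (s : (Δ[n] : SSet.{v}).obj (op m)) : s ∈ (SSet.boundary.{v} n).obj (op m) := by
  obtain ⟨m⟩ := m
  exact (SSet.boundary_obj_eq_univ m n h).symm ▸ Set.mem_univ s

/-- A simplex of the boundary is a degeneracy of a proper face. -/
lemma exists_fac_of_mem_boundary {n : ℕ} {m : SimplexCategory} (g : m ⟶ ⦋n⦌)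
    (h : SSet.stdSimplex.objEquiv.symm g ∈ (SSet.boundary.{v} n).obj (op m)) :
    ∃ (A : LatchingCategory ⦋n⦌) (e : m ⟶ A.obj.left), e ≫ A.obj.hom = g := by
  refine ⟨⟨Over.mk (image.ι g), inferInstanceAs (Mono (image.ι g)), ?_⟩,
    factorThruImage g, image.fac g⟩
  -- An image of full length would have an identity as its inclusion, making `g` surjective;
  -- membership in the boundary says that it is not.
  refine SimplexCategory.len_lt_of_mono (image.ι g) fun heq ↦ h ?_
  have : Epi (image.ι g) := by
    have key {x : SimplexCategory} (i : x ⟶ ⦋n⦌) [Mono i] (hx : ⦋n⦌ = x) : Epi i := by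
      subst hx
      rw [SimplexCategory.eq_id_of_mono i]
      infer_instance
    exact key _ heq
  have : Epi g := by
    rw [← image.fac g]
    infer_instance
  exact SimplexCategory.epi_iff_surjective.1 this

/-! ### Maps from boundaries as maps from latching objects -/

section

variable [HasFiniteColimits C] {A : SimplexCategory ⥤ C} {Z : C} {n : ℕ}

/-- The inclusion of a proper face in the latching object. -/
def latchingι (A : SimplexCategory ⥤ C) {n : SimplexCategory} (i : LatchingCategory n) :
    A.obj i.obj.left ⟶ latchingObj A n :=
  colimit.ι (latchingDiagram A n) i

lemma latchingObj_hom_ext {A : SimplexCategory ⥤ C} {n : SimplexCategory}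
    {Z : C} {f g : latchingObj A n ⟶ Z}
    (h : ∀ i : LatchingCategory n, latchingι A i ≫ f = latchingι A i ≫ g) : f = g :=
  colimit.hom_ext h

/-- A compatible family of maps on the proper faces induces a map on the latching object. -/
def latchingDesc {A : SimplexCategory ⥤ C} {n : SimplexCategory} {Z : C}
    (s : ∀ i : LatchingCategory n, A.obj i.obj.left ⟶ Z)
    (hs : ∀ ⦃i j : LatchingCategory n⦄ (f : i ⟶ j), A.map f.hom.left ≫ s j = s i) :
    latchingObj A n ⟶ Z :=
  colimit.desc (latchingDiagram A n)
    { pt := Z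
      ι :=
        { app := s
          naturality := fun _ _ f ↦ (hs f).trans (Category.comp_id _).symm } }

lemma ι_latchingDesc {A : SimplexCategory ⥤ C} {n : SimplexCategory} {Z : C}
    (s : ∀ i : LatchingCategory n, A.obj i.obj.left ⟶ Z)
    (hs : ∀ ⦃i j : LatchingCategory n⦄ (f : i ⟶ j), A.map f.hom.left ≫ s j = s i)
    (i : LatchingCategory n) : latchingι A i ≫ latchingDesc s hs = s i :=
  colimit.ι_desc _ _

lemma ι_latchingDesc_assoc {A : SimplexCategory ⥤ C} {n : SimplexCategory} {Z : C}
    (s : ∀ i : LatchingCategory n, A.obj i.obj.left ⟶ Z)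
    (hs : ∀ ⦃i j : LatchingCategory n⦄ (f : i ⟶ j), A.map f.hom.left ≫ s j = s i)
    (i : LatchingCategory n)
    {T' : C} (k : Z ⟶ T') :
    latchingι A i ≫ latchingDesc s hs ≫ k = s i ≫ k :=
  (Category.assoc _ _ _).symm.trans (congrArg (· ≫ k) (ι_latchingDesc s hs i))

lemma latchingι_w (A : SimplexCategory ⥤ C) {n : SimplexCategory} {i j : LatchingCategory n}
    (f : i ⟶ j) : A.map f.hom.left ≫ latchingι A j = latchingι A i :=
  colimit.w (latchingDiagram A n) f

lemma latchingι_w_assoc (A : SimplexCategory ⥤ C) {n : SimplexCategory} {i j : LatchingCategory n}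
    (f : i ⟶ j)
    {T' : C} (k : latchingObj A n ⟶ T') :
    A.map f.hom.left ≫ latchingι A j ≫ k = latchingι A i ≫ k :=
  (Category.assoc _ _ _).symm.trans (congrArg (· ≫ k) (latchingι_w A f))

lemma ι_latchingMap (A : SimplexCategory ⥤ C) {n : SimplexCategory} (i : LatchingCategory n) :
    latchingι A i ≫ latchingMap A n = A.map i.obj.hom :=
  colimit.ι_desc _ _

lemma ι_latchingMap_assoc (A : SimplexCategory ⥤ C) {n : SimplexCategory}
    (i : LatchingCategory n)
    {T' : C} (k : A.obj n ⟶ T') :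
    latchingι A i ≫ latchingMap A n ≫ k = A.map i.obj.hom ≫ k :=
  (Category.assoc _ _ _).symm.trans (congrArg (· ≫ k) (ι_latchingMap A i))

lemma ι_latchingObjMap {A B : SimplexCategory ⥤ C} (f : A ⟶ B) {n : SimplexCategory}
    (i : LatchingCategory n) :
    latchingι A i ≫ latchingObjMap f n = f.app i.obj.left ≫ latchingι B i :=
  ι_colimMap _ _

lemma ι_latchingObjMap_assoc {A B : SimplexCategory ⥤ C} (f : A ⟶ B) {n : SimplexCategory}
    (i : LatchingCategory n)
    {T' : C} (k : latchingObj B n ⟶ T') :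
    latchingι A i ≫ latchingObjMap f n ≫ k = f.app i.obj.left ≫ latchingι B i ≫ k :=
  (Category.assoc _ _ _).symm.trans ((congrArg (· ≫ k) (ι_latchingObjMap f i)).trans (Category.assoc _ _ _))

/-- The restriction to a proper face of a map from the boundary. -/
def faceOfBoundary (b : (∂Δ[n] : SSet.{v}) ⟶ mappingSpace A Z) (i : LatchingCategory ⦋n⦌) :
    A.obj i.obj.left ⟶ Z :=
  b.app (op i.obj.left)
    ⟨SSet.stdSimplex.objEquiv.symm i.obj.hom, mem_boundary_of_len_lt i.property.2 _⟩

/-- The map from the latching object that corresponds to a map from the boundary. -/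
def latchingObjDescOfBoundary (b : (∂Δ[n] : SSet.{v}) ⟶ mappingSpace A Z) :
    latchingObj A ⦋n⦌ ⟶ Z :=
  latchingDesc (faceOfBoundary b) fun i j f ↦ by
    have := ConcreteCategory.congr_hom (b.naturality f.hom.left.op)
      ⟨SSet.stdSimplex.objEquiv.symm j.obj.hom, mem_boundary_of_len_lt j.property.2 _⟩
    refine this.symm.trans ?_
    refine congrArg (b.app (op i.obj.left)) (Subtype.ext ?_)
    exact congrArg SSet.stdSimplex.objEquiv.symm (Over.w f.hom)

lemma ι_latchingObjDescOfBoundary (b : (∂Δ[n] : SSet.{v}) ⟶ mappingSpace A Z)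
    (i : LatchingCategory ⦋n⦌) :
    latchingι A i ≫ latchingObjDescOfBoundary b = faceOfBoundary b i :=
  ι_latchingDesc _ _ _

lemma ι_latchingObjDescOfBoundary_assoc (b : (∂Δ[n] : SSet.{v}) ⟶ mappingSpace A Z)
    (i : LatchingCategory ⦋n⦌)
    {T' : C} (k : Z ⟶ T') :
    latchingι A i ≫ latchingObjDescOfBoundary b ≫ k = faceOfBoundary b i ≫ k :=
  (Category.assoc _ _ _).symm.trans (congrArg (· ≫ k) (ι_latchingObjDescOfBoundary b i))

/-- The map from the standard simplex that corresponds to a simplex of the mapping space. -/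
def simplexOfHom (l : A.obj ⦋n⦌ ⟶ Z) : (Δ[n] : SSet.{v}) ⟶ mappingSpace A Z :=
  SSet.yonedaEquiv.symm l

/-- Each simplex of the boundary is a degeneracy of a proper face, so agreement on proper faces,
which is what `h` expresses, suffices. -/
lemma boundary_ι_simplexOfHom (b : (∂Δ[n] : SSet.{v}) ⟶ mappingSpace A Z) (l : A.obj ⦋n⦌ ⟶ Z)
    (h : latchingMap A ⦋n⦌ ≫ l = latchingObjDescOfBoundary b) :
    (SSet.boundary n).ι ≫ simplexOfHom l = b := by
  refine NatTrans.ext (funext fun ⟨m⟩ ↦ ?_)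
  ext ⟨s, hs⟩
  obtain ⟨g, rfl⟩ := SSet.stdSimplex.objEquiv.symm.surjective s
  obtain ⟨i, e, rfl⟩ := exists_fac_of_mem_boundary g hs
  have h₁ := ConcreteCategory.congr_hom (b.naturality e.op)
    ⟨SSet.stdSimplex.objEquiv.symm i.obj.hom, mem_boundary_of_len_lt i.property.2 _⟩
  refine Eq.trans ?_ h₁.symm
  change A.map (e ≫ i.obj.hom) ≫ l = A.map e ≫ faceOfBoundary b i
  rw [← ι_latchingObjDescOfBoundary, ← h, ι_latchingMap_assoc, A.map_comp, Category.assoc]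

/-- Two maps from a standard simplex agree if they classify the same simplex. -/
lemma stdSimplex_hom_ext {X : SSet.{v}} {f g : (Δ[n] : SSet.{v}) ⟶ X}
    (h : SSet.yonedaEquiv f = SSet.yonedaEquiv g) : f = g :=
  SSet.yonedaEquiv.injective h

/-- A square from ∂Δ[n] → Δ[n] to this map consists of `w` (the boundary) and `u` (the simplex). The
hypothesis is the extension property of the relative latching map into `Z`, written without the
pushout. -/
lemma rlp_mappingSpaceMapLeft {A B : SimplexCategory ⥤ C} (f : A ⟶ B) (Z : C)
    (H : ∀ (n : SimplexCategory) (u : A.obj n ⟶ Z) (w : latchingObj B n ⟶ Z),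
      latchingObjMap f n ≫ w = latchingMap A n ≫ u →
        ∃ l, latchingMap B n ≫ l = w ∧ f.app n ≫ l = u) :
    SSet.modelCategoryQuillen.I.rlp (mappingSpaceMapLeft f Z) := by
  rintro _ _ _ ⟨n⟩
  refine ⟨fun {b t} sq ↦ ?_⟩
  obtain ⟨l, h₁, h₂⟩ := H ⦋n⦌ (homOfSimplex t) (latchingObjDescOfBoundary b) (by
    refine latchingObj_hom_ext fun i ↦ ?_
    rw [ι_latchingObjMap_assoc, ι_latchingObjDescOfBoundary, ι_latchingMap_assoc,
      map_homOfSimplex]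
    exact ConcreteCategory.congr_hom (congr_app sq.w (op i.obj.left))
      ⟨SSet.stdSimplex.objEquiv.symm i.obj.hom, mem_boundary_of_len_lt i.property.2 _⟩)
  refine ⟨⟨⟨simplexOfHom l, boundary_ι_simplexOfHom b l h₁, ?_⟩⟩⟩
  apply stdSimplex_hom_ext
  refine Eq.trans ?_ h₂
  change f.app _ ≫ B.map (𝟙 _) ≫ l = _
  simp

/-- The same translation, now with `A` fixed: the lifting problem becomes one of the latching map of
`A` against `q`. -/
lemma rlp_mappingSpaceMapRight (A : SimplexCategory ⥤ C) {Z T : C} (q : Z ⟶ T)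
    (H : ∀ n : SimplexCategory, HasLiftingProperty (latchingMap A n) q) :
    SSet.modelCategoryQuillen.I.rlp (mappingSpaceMapRight A q) := by
  rintro _ _ _ ⟨n⟩
  refine ⟨fun {b t} sq ↦ ?_⟩
  have := H ⦋n⦌
  have sq' : CommSq (latchingObjDescOfBoundary b) (latchingMap A ⦋n⦌) q (homOfSimplex t) := ⟨by
    refine latchingObj_hom_ext fun i ↦ ?_
    rw [ι_latchingObjDescOfBoundary_assoc, ι_latchingMap_assoc, map_homOfSimplex]
    exact ConcreteCategory.congr_hom (congr_app sq.w (op i.obj.left))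
      ⟨SSet.stdSimplex.objEquiv.symm i.obj.hom, mem_boundary_of_len_lt i.property.2 _⟩⟩
  refine ⟨⟨⟨simplexOfHom sq'.lift, boundary_ι_simplexOfHom b _ sq'.fac_left, ?_⟩⟩⟩
  apply stdSimplex_hom_ext
  refine Eq.trans ?_ sq'.fac_right
  change (A.map (𝟙 _) ≫ sq'.lift) ≫ q = _
  simp

lemma inl_relativeLatchingMap {A B : SimplexCategory ⥤ C} (f : A ⟶ B) (n : SimplexCategory) :
    pushout.inl (latchingObjMap f n) (latchingMap A n) ≫ relativeLatchingMap f n =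
      latchingMap B n :=
  pushout.inl_desc _ _ _

lemma inr_relativeLatchingMap {A B : SimplexCategory ⥤ C} (f : A ⟶ B) (n : SimplexCategory) :
    pushout.inr (latchingObjMap f n) (latchingMap A n) ≫ relativeLatchingMap f n = f.app n :=
  pushout.inr_desc _ _ _

/-- The lifting property of relative latching maps, without pushouts. -/
lemma hasLiftingProperty_relativeLatchingMap_iff {A B : SimplexCategory ⥤ C} (f : A ⟶ B)
    (n : SimplexCategory) {E S : C} (q : E ⟶ S) :
    HasLiftingProperty (relativeLatchingMap f n) q ↔
      ∀ (u : A.obj n ⟶ E) (w : latchingObj B n ⟶ E) (z : B.obj n ⟶ S),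
        latchingObjMap f n ≫ w = latchingMap A n ≫ u → latchingMap B n ≫ z = w ≫ q →
        f.app n ≫ z = u ≫ q →
        ∃ l, latchingMap B n ≫ l = w ∧ f.app n ≫ l = u ∧ l ≫ q = z := by
  constructor
  · intro H u w z h₁ h₂ h₃
    have sq : CommSq (pushout.desc w u h₁) (relativeLatchingMap f n) q z := ⟨by
      apply pushout.hom_ext
      · rw [pushout.inl_desc_assoc, ← Category.assoc, inl_relativeLatchingMap, h₂]
      · rw [pushout.inr_desc_assoc, ← Category.assoc, inr_relativeLatchingMap, h₃]⟩
    refine ⟨sq.lift, ?_, ?_, sq.fac_right⟩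
    · rw [← inl_relativeLatchingMap f n, Category.assoc, sq.fac_left, pushout.inl_desc]
    · rw [← inr_relativeLatchingMap f n, Category.assoc, sq.fac_left, pushout.inr_desc]
  · intro H
    refine ⟨fun {t z} sq ↦ ?_⟩
    obtain ⟨l, h₁, h₂, h₃⟩ := H (pushout.inr _ _ ≫ t) (pushout.inl _ _ ≫ t) z
      (by rw [pushout.condition_assoc])
      (by rw [← inl_relativeLatchingMap f n, Category.assoc, ← sq.w, Category.assoc])
      (by rw [← inr_relativeLatchingMap f n, Category.assoc, ← sq.w, Category.assoc])
    refine ⟨⟨⟨l, ?_, h₃⟩⟩⟩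
    apply pushout.hom_ext
    · rw [← Category.assoc, inl_relativeLatchingMap, h₁]
    · rw [← Category.assoc, inr_relativeLatchingMap, h₂]

end
end

/-! ### Sections built by induction on the degree -/

/-- A family of sets with transition maps over a category in which all nonidentity maps lower
the degree has a compatible section as soon as compatible partial sections extend over each
object. -/
lemma exists_compatible_section {I : Type*} [Category I] (deg : I → ℕ) (N : ℕ)
    (hN : ∀ i, deg i < N)
    (hdeg : ∀ {i j : I} (f : i ⟶ j), deg j < deg i ∨ ∃ h : i = j, f = eqToHom h)
    (G : I → Type*) (map : ∀ {i j : I}, (i ⟶ j) → G i → G j)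
    (map_id : ∀ (i : I) (x : G i), map (𝟙 i) x = x)
    (extend : ∀ (i : I) (s : ∀ (j : I), (i ⟶ j) → deg j < deg i → G j),
      (∀ (j k : I) (f : i ⟶ j) (g : j ⟶ k) (hj : deg j < deg i) (hk : deg k < deg i),
        map g (s j f hj) = s k (f ≫ g) hk) →
      ∃ x : G i, ∀ (j : I) (f : i ⟶ j) (hj : deg j < deg i), map f x = s j f hj) :
    ∃ s : ∀ i, G i, ∀ (i j : I) (f : i ⟶ j), map f (s i) = s j := by
  have key : ∀ M : ℕ, ∃ s : ∀ i, deg i < M → G i, ∀ (i j : I) (f : i ⟶ j)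
      (hi : deg i < M) (hj : deg j < M), map f (s i hi) = s j hj := by
    intro M
    induction M with
    | zero => exact ⟨fun i hi ↦ absurd hi (Nat.not_lt_zero _), fun i j f hi ↦
        absurd hi (Nat.not_lt_zero _)⟩
    | succ M ih =>
      obtain ⟨s, hs⟩ := ih
      have ex (i : I) (hi : deg i = M) : ∃ x : G i, ∀ (j : I) (f : i ⟶ j) (hj : deg j < deg i),
          map f x = s j (hi ▸ hj) :=
        extend i (fun j _ hj ↦ s j (hi ▸ hj)) (fun j k _ g _ _ ↦ hs j k g _ _)
      choose x hx using ex
      refine ⟨fun i hi ↦ if h : deg i < M then s i h else x i (by omega),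
        fun i j f hi hj ↦ ?_⟩
      -- Distinct objects of equal degree have no maps between them, so the values chosen in degree
      -- `M` need only be compatible with lower ones.
      obtain h | ⟨rfl, rfl⟩ := hdeg f
      · have hjM : deg j < M := by omega
        by_cases hiM : deg i < M
        · simp only [hiM, hjM, dite_true]
          exact hs _ _ _ _ _
        · simp only [hiM, hjM, dite_true, dite_false]
          exact hx _ _ _ _ h
      · exact map_id _ _
  obtain ⟨s, hs⟩ := key N
  exact ⟨fun i ↦ s i (hN i), fun i j f ↦ hs i j f _ _⟩

/-! ### Levelwise weak equivalences that are Reedy cofibrations -/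

section

variable {C : Type u} [Category.{v} C] [HasFiniteColimits C]

lemma LatchingCategory.len_lt {n : SimplexCategory} (i : LatchingCategory n) :
    i.obj.left.len < n.len :=
  i.property.2

/-- A proper face of a proper face. -/
def LatchingCategory.comp {n : SimplexCategory} (i : LatchingCategory n)
    (j : LatchingCategory i.obj.left) : LatchingCategory n :=
  ⟨Over.mk (j.obj.hom ≫ i.obj.hom), by
    have := i.property.1
    have := j.property.1
    exact inferInstanceAs (Mono (j.obj.hom ≫ i.obj.hom)), j.len_lt.trans i.len_lt⟩

/-- The inclusion of a proper face of a proper face. -/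
def LatchingCategory.compHom {n : SimplexCategory} (i : LatchingCategory n)
    (j : LatchingCategory i.obj.left) : i.comp j ⟶ i :=
  ObjectProperty.homMk (Over.homMk j.obj.hom rfl)

lemma LatchingCategory.mono_left {n : SimplexCategory} {i j : LatchingCategory n} (f : i ⟶ j) :
    Mono f.hom.left := by
  have := i.property.1
  have h : Mono (f.hom.left ≫ j.obj.hom) := by
    rw [Over.w]
    exact this
  exact mono_of_mono _ j.obj.hom

/-- An injection between ordinals of equal length is an identity. Hence `exists_compatible_section`
applies to the opposite of the latching category. -/
lemma LatchingCategory.len_lt_or_eq {n : SimplexCategory} {i j : LatchingCategory n}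
    (f : i ⟶ j) : i.obj.left.len < j.obj.left.len ∨ ∃ h : i = j, f = eqToHom h := by
  have hf := mono_left f
  obtain ⟨⟨⟨k⟩, ⟨⟨⟩⟩, a⟩, ha⟩ := i
  obtain ⟨⟨⟨l⟩, ⟨⟨⟩⟩, b⟩, hb⟩ := j
  by_cases h : k < l
  · exact Or.inl h
  · have : k ≤ l := SimplexCategory.len_le_of_mono f.hom.left
    obtain rfl : k = l := by omega
    have hid : f.hom.left = 𝟙 _ := SimplexCategory.eq_id_of_mono (x := ⦋k⦌) f.hom.left
    have hab : a = b := by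
      have := Over.w f.hom
      rw [hid] at this
      exact this.symm.trans (Category.id_comp b)
    subst hab
    refine Or.inr ⟨rfl, ?_⟩
    ext1
    exact Over.OverMorphism.ext hid

/-- If the relative latching maps in lower degrees have the left lifting property against `q`,
then so does the map of latching objects. -/
lemma hasLiftingProperty_latchingObjMap {A B : SimplexCategory ⥤ C} (f : A ⟶ B)
    (n : SimplexCategory) {E S : C} (q : E ⟶ S)
    (H : ∀ m : SimplexCategory, m.len < n.len → HasLiftingProperty (relativeLatchingMap f m) q) :
    HasLiftingProperty (latchingObjMap f n) q := by
  refine ⟨fun {u z} sq ↦ ?_⟩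
  -- The lift on the colimit is assembled from compatible lifts on the faces, chosen by induction on
  -- dimension.
  obtain ⟨s, hs⟩ := exists_compatible_section (I := (LatchingCategory n)ᵒᵖ)
    (fun i ↦ i.unop.obj.left.len) n.len (fun i ↦ i.unop.len_lt)
    (fun {i j} g ↦ by
      obtain h | ⟨h, h'⟩ := LatchingCategory.len_lt_or_eq g.unop
      · exact Or.inl h
      · refine Or.inr ⟨Opposite.unop_injective h.symm, ?_⟩
        apply Quiver.Hom.unop_inj
        rw [h', eqToHom_unop])
    (fun i ↦ { b : B.obj i.unop.obj.left ⟶ E //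
      f.app _ ≫ b = latchingι A i.unop ≫ u ∧ b ≫ q = latchingι B i.unop ≫ z })
    (fun {i j} g b ↦ ⟨B.map g.unop.hom.left ≫ b.1, by
      rw [← f.naturality_assoc, b.2.1, latchingι_w_assoc], by
      rw [Category.assoc, b.2.2, latchingι_w_assoc]⟩)
    (fun i b ↦ Subtype.ext (by
      change B.map (𝟙 _) ≫ b.1 = b.1
      simp))
    (fun i s hs ↦ by
      have := H _ i.unop.len_lt
      rw [hasLiftingProperty_relativeLatchingMap_iff] at this
      have hcomp (j : LatchingCategory i.unop.obj.left) (k : LatchingCategory n)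
          (g : k ⟶ i.unop.comp j) (hk : k.obj.left.len < i.unop.obj.left.len) :
          B.map g.hom.left ≫ (s (op (i.unop.comp j)) (i.unop.compHom j).op j.len_lt).1 =
            (s (op k) ((i.unop.compHom j).op ≫ g.op) hk).1 :=
        congrArg Subtype.val (hs (op (i.unop.comp j)) (op k) (i.unop.compHom j).op g.op
          j.len_lt hk)
      -- The lifts already chosen on the proper faces of the face `i` form a map on its latching
      -- object, which the relative latching map at `i` then extends.
      obtain ⟨t, ht⟩ : ∃ t : ∀ j : LatchingCategory i.unop.obj.left, B.obj j.obj.left ⟶ E,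
          ∀ j, t j = (s (op (i.unop.comp j)) (i.unop.compHom j).op j.len_lt).1 :=
        ⟨_, fun _ ↦ rfl⟩
      have key (j k : LatchingCategory i.unop.obj.left) (g : j ⟶ k) :
          B.map g.hom.left ≫ t k = t j := by
        let g' : i.unop.comp j ⟶ i.unop.comp k := ObjectProperty.homMk (Over.homMk g.hom.left (by
          change g.hom.left ≫ k.obj.hom ≫ i.unop.obj.hom = j.obj.hom ≫ i.unop.obj.hom
          rw [Over.w_assoc]))
        rw [ht, ht]
        refine (hcomp k _ g' j.len_lt).trans ?_
        have : (i.unop.compHom k).op ≫ g'.op = (i.unop.compHom j).op := by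
          apply Quiver.Hom.unop_inj
          ext1
          exact Over.OverMorphism.ext (Over.w g.hom)
        rw [this]
      have ht₁ (j) : f.app j.obj.left ≫ t j = A.map j.obj.hom ≫ latchingι A i.unop ≫ u := by
        rw [ht]
        refine (s (op (i.unop.comp j)) (i.unop.compHom j).op j.len_lt).2.1.trans ?_
        exact (latchingι_w_assoc A (i.unop.compHom j) _).symm
      have ht₂ (j) : t j ≫ q = B.map j.obj.hom ≫ latchingι B i.unop ≫ z := by
        rw [ht]
        refine (s (op (i.unop.comp j)) (i.unop.compHom j).op j.len_lt).2.2.trans ?_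
        exact (latchingι_w_assoc B (i.unop.compHom j) _).symm
      obtain ⟨l, h₁, h₂, h₃⟩ := this (latchingι A i.unop ≫ u) (latchingDesc t key)
        (latchingι B i.unop ≫ z)
        (latchingObj_hom_ext fun j ↦ by
          rw [ι_latchingObjMap_assoc, ι_latchingDesc, ι_latchingMap_assoc, ht₁])
        (latchingObj_hom_ext fun j ↦ by
          rw [ι_latchingDesc_assoc, ι_latchingMap_assoc, ht₂])
        (by rw [← ι_latchingObjMap_assoc, ← sq.w, Category.assoc])
      refine ⟨⟨l, h₂, h₃⟩, fun j g hj ↦ Subtype.ext ?_⟩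
      change B.map g.unop.hom.left ≫ l = (s j g hj).1
      -- A lower face `j` mapping to `i` is itself a proper face of `i`; `g'` below identifies the
      -- two presentations.
      let j' : LatchingCategory i.unop.obj.left :=
        ⟨Over.mk g.unop.hom.left, LatchingCategory.mono_left g.unop, hj⟩
      have h₄ : B.map g.unop.hom.left ≫ l = t j' := by
        rw [← ι_latchingDesc t key j', ← h₁, ι_latchingMap_assoc]
        rfl
      let g' : j.unop ⟶ i.unop.comp j' := ObjectProperty.homMk (Over.homMk (𝟙 _) (by
        refine (Category.id_comp _).trans ?_
        exact Over.w g.unop.hom))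
      have h₅ : B.map (𝟙 _) ≫ t j' = (s (op j.unop) ((i.unop.compHom j').op ≫ g'.op) hj).1 := by
        rw [ht]
        exact hcomp j' j.unop g' hj
      rw [B.map_id, Category.id_comp] at h₅
      rw [h₄, h₅]
      have : (i.unop.compHom j').op ≫ g'.op = g := by
        apply Quiver.Hom.unop_inj
        ext1
        exact Over.OverMorphism.ext (Category.id_comp _)
      rw [this])
  have hs' (i j : LatchingCategory n) (g : i ⟶ j) :
      B.map g.hom.left ≫ (s (op j)).1 = (s (op i)).1 := congrArg Subtype.val (hs _ _ g.op)
  refine ⟨⟨⟨latchingDesc (fun i ↦ (s (op i)).1) hs', ?_, ?_⟩⟩⟩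
  · refine latchingObj_hom_ext fun i ↦ ?_
    rw [ι_latchingObjMap_assoc, ι_latchingDesc]
    exact (s (op i)).2.1
  · refine latchingObj_hom_ext fun i ↦ ?_
    rw [ι_latchingDesc_assoc]
    exact (s (op i)).2.2

end

section

variable {C : Type u} [Category.{v} C] [ModelCategory C]

/-- The relative latching maps of a Reedy cofibration that is a levelwise weak equivalence are
trivial cofibrations. -/
lemma weakEquivalence_relativeLatchingMap {A B : SimplexCategory ⥤ C} (f : A ⟶ B)
    (hf : IsReedyCofibration f) (hf' : ∀ n, WeakEquivalence (f.app n)) (n : SimplexCategory) :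
    WeakEquivalence (relativeLatchingMap f n) := by
  induction hn : n.len using Nat.strong_induction_on generalizing n with
  | _ N ih =>
    have htriv : trivialCofibrations C (latchingObjMap f n) := by
      rw [← fibrations_llp]
      intro E S q hq
      rw [← fibration_iff] at hq
      refine hasLiftingProperty_latchingObjMap f n q fun m hm ↦ ?_
      have := hf m
      have := ih m.len (hn ▸ hm) m rfl
      infer_instance
    rw [mem_trivialCofibrations_iff] at htriv
    obtain ⟨_, _⟩ := htriv
    have := hf' n
    -- `pushout.inr` is a cobase change of the trivial cofibration `latchingObjMap f n`, so
    -- two-out-of-three applies.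
    exact weakEquivalence_of_precomp_of_fac (inr_relativeLatchingMap f n)

end

/-! ### Matching objects -/

/-- The proper surjections out of `n`, as a property of objects under `n`. -/
def matchingProperty (n : SimplexCategory) : ObjectProperty (Under n) :=
  fun A ↦ Epi A.hom ∧ A.right.len < n.len

/-- The matching category of the simplex category at `n`: its objects are the proper surjections
out of `n`. -/
abbrev MatchingCategory (n : SimplexCategory) : Type :=
  (matchingProperty n).FullSubcategory

lemma MatchingCategory.len_lt {n : SimplexCategory} (e : MatchingCategory n) :
    e.obj.right.len < n.len :=
  e.property.2

instance MatchingCategory.epi_hom {n : SimplexCategory} (e : MatchingCategory n) :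
    Epi e.obj.hom :=
  e.property.1

/-- The object of the matching category given by a proper surjection. -/
def MatchingCategory.mk {n k : SimplexCategory} (e : n ⟶ k) [Epi e] (h : k.len < n.len) :
    MatchingCategory n :=
  ⟨Under.mk e, inferInstanceAs (Epi e), h⟩

instance (n : SimplexCategory) : Finite (MatchingCategory n) := by
  let φ : MatchingCategory n → Σ k : Fin n.len, (n ⟶ ⦋(k : ℕ)⦌) :=
    fun A ↦ ⟨⟨A.obj.right.len, A.property.2⟩, A.obj.hom⟩
  refine Finite.of_injective φ ?_
  rintro ⟨⟨⟨⟨⟩⟩, ⟨k⟩, f⟩, hf⟩ ⟨⟨⟨⟨⟩⟩, ⟨l⟩, g⟩, hg⟩ h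
  simp only [φ, Sigma.mk.injEq, Fin.mk.injEq] at h
  obtain ⟨h₁, h₂⟩ := h
  change k = l at h₁
  subst h₁
  obtain rfl := eq_of_heq h₂
  rfl

instance (n : SimplexCategory) (A B : MatchingCategory n) : Finite (A ⟶ B) :=
  Finite.of_injective (fun f ↦ f.hom.right) (fun f g h ↦ by
    ext1
    exact Under.UnderMorphism.ext h)

instance (n : SimplexCategory) : FinCategory (MatchingCategory n) where
  fintypeObj := Fintype.ofFinite _
  fintypeHom _ _ := Fintype.ofFinite _

lemma MatchingCategory.epi_right {n : SimplexCategory} {i j : MatchingCategory n} (f : i ⟶ j) :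
    Epi f.hom.right := by
  have h : Epi (i.obj.hom ≫ f.hom.right) := by
    rw [Under.w]
    exact j.property.1
  exact epi_of_epi i.obj.hom _

lemma MatchingCategory.len_lt_or_eq {n : SimplexCategory} {i j : MatchingCategory n}
    (f : i ⟶ j) : j.obj.right.len < i.obj.right.len ∨ ∃ h : i = j, f = eqToHom h := by
  have hf := epi_right f
  obtain ⟨⟨⟨⟨⟩⟩, ⟨k⟩, a⟩, ha⟩ := i
  obtain ⟨⟨⟨⟨⟩⟩, ⟨l⟩, b⟩, hb⟩ := j
  by_cases h : l < k
  · exact Or.inl h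
  · have : l ≤ k := SimplexCategory.len_le_of_epi f.hom.right
    obtain rfl : k = l := by omega
    have hid : f.hom.right = 𝟙 _ := SimplexCategory.eq_id_of_epi (x := ⦋k⦌) f.hom.right
    have hab : a = b := by
      have := Under.w f.hom
      rw [hid] at this
      exact (Category.comp_id a).symm.trans this
    subst hab
    refine Or.inr ⟨rfl, ?_⟩
    ext1
    exact Under.UnderMorphism.ext hid

/-- A proper quotient of a proper quotient. -/
def MatchingCategory.comp {n : SimplexCategory} (i : MatchingCategory n)
    (j : MatchingCategory i.obj.right) : MatchingCategory n :=
  ⟨Under.mk (i.obj.hom ≫ j.obj.hom), by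
    exact inferInstanceAs (Epi (i.obj.hom ≫ j.obj.hom)), j.len_lt.trans i.len_lt⟩

/-- The projection to a proper quotient of a proper quotient. -/
def MatchingCategory.compHom {n : SimplexCategory} (i : MatchingCategory n)
    (j : MatchingCategory i.obj.right) : i ⟶ i.comp j :=
  ObjectProperty.homMk (Under.homMk j.obj.hom rfl)

section

variable {C : Type u} [Category.{v} C] [HasFiniteLimits C]

/-- The diagram whose limit is the matching object. -/
abbrev matchingDiagram (W : SimplexCategory ⥤ C) (n : SimplexCategory) :
    MatchingCategory n ⥤ C :=
  ((matchingProperty n).ι ⋙ Under.forget n) ⋙ W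

/-- The matching object. -/
def matchingObj (W : SimplexCategory ⥤ C) (n : SimplexCategory) : C :=
  limit (matchingDiagram W n)

/-- The projections of the matching object. -/
def matchingπ (W : SimplexCategory ⥤ C) {n : SimplexCategory} (e : MatchingCategory n) :
    matchingObj W n ⟶ W.obj e.obj.right :=
  limit.π (matchingDiagram W n) e

/-- A compatible family of maps to the proper quotients induces a map to the matching object. -/
def matchingLift {W : SimplexCategory ⥤ C} {n : SimplexCategory} {Z : C}
    (s : ∀ e : MatchingCategory n, Z ⟶ W.obj e.obj.right)
    (hs : ∀ ⦃i j : MatchingCategory n⦄ (f : i ⟶ j), s i ≫ W.map f.hom.right = s j) :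
    Z ⟶ matchingObj W n :=
  limit.lift (matchingDiagram W n)
    { pt := Z
      π :=
        { app := s
          naturality := fun _ _ f ↦ (Category.id_comp _).trans (hs f).symm } }

lemma matchingLift_π {W : SimplexCategory ⥤ C} {n : SimplexCategory} {Z : C}
    (s : ∀ e : MatchingCategory n, Z ⟶ W.obj e.obj.right)
    (hs : ∀ ⦃i j : MatchingCategory n⦄ (f : i ⟶ j), s i ≫ W.map f.hom.right = s j)
    (e : MatchingCategory n) : matchingLift s hs ≫ matchingπ W e = s e :=
  limit.lift_π _ _

lemma matchingπ_w (W : SimplexCategory ⥤ C) {n : SimplexCategory} {i j : MatchingCategory n}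
    (f : i ⟶ j) : matchingπ W i ≫ W.map f.hom.right = matchingπ W j :=
  limit.w (matchingDiagram W n) f

lemma matchingObj_hom_ext {W : SimplexCategory ⥤ C} {n : SimplexCategory} {Z : C}
    {f g : Z ⟶ matchingObj W n}
    (h : ∀ e : MatchingCategory n, f ≫ matchingπ W e = g ≫ matchingπ W e) : f = g :=
  limit.hom_ext h

/-- The canonical map to the matching object. -/
def matchingMap (W : SimplexCategory ⥤ C) (n : SimplexCategory) : W.obj n ⟶ matchingObj W n :=
  matchingLift (fun e ↦ W.map e.obj.hom) (fun i j f ↦ by rw [← W.map_comp, Under.w])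

lemma matchingMap_π (W : SimplexCategory ⥤ C) {n : SimplexCategory} (e : MatchingCategory n) :
    matchingMap W n ≫ matchingπ W e = W.map e.obj.hom :=
  matchingLift_π _ _ _

lemma matchingMap_π_assoc (W : SimplexCategory ⥤ C) {n : SimplexCategory}
    (e : MatchingCategory n)
    {T' : C} (k : W.obj e.obj.right ⟶ T') :
    matchingMap W n ≫ matchingπ W e ≫ k = W.map e.obj.hom ≫ k :=
  (Category.assoc _ _ _).symm.trans (congrArg (· ≫ k) (matchingMap_π W e))

/-- Lifting the surjection of `e` against the injection `i'` gives a map `e ⟶ e'` in the matching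
category. Thus the projection attached to a noninjective map does not depend on its factorization.
-/
lemma matchingπ_map_eq (W : SimplexCategory ⥤ C) {n m : SimplexCategory}
    (e e' : MatchingCategory n) (i : e.obj.right ⟶ m) (i' : e'.obj.right ⟶ m) [Mono i']
    (h : e.obj.hom ≫ i = e'.obj.hom ≫ i') :
    matchingπ W e ≫ W.map i = matchingπ W e' ≫ W.map i' := by
  have := strongEpi_of_epi e.obj.hom
  have sq : CommSq e'.obj.hom e.obj.hom i' i := ⟨h.symm⟩
  let f : e ⟶ e' := ObjectProperty.homMk (Under.homMk sq.lift sq.fac_left)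
  rw [← matchingπ_w W f, Category.assoc, ← W.map_comp]
  exact congrArg (matchingπ W e ≫ W.map ·) sq.fac_right.symm

lemma len_image_lt {n m : SimplexCategory} (θ : n ⟶ m) (h : ¬ Mono θ) :
    (image θ).len < n.len := by
  refine lt_of_le_of_ne (SimplexCategory.len_le_of_epi (factorThruImage θ)) fun heq ↦ h ?_
  have key {x : SimplexCategory} (e : n ⟶ x) [Epi e] (hx : x = n) : Mono e := by
    subst hx
    rw [SimplexCategory.eq_id_of_epi e]
    infer_instance
  have := key (factorThruImage θ) (SimplexCategory.ext heq)
  rw [← image.fac θ]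
  infer_instance

/-- A noninjective map is a proper surjection followed by an injection. -/
lemma exists_fac_of_not_mono {n m : SimplexCategory} (θ : n ⟶ m) (h : ¬ Mono θ) :
    ∃ (e : MatchingCategory n) (i : e.obj.right ⟶ m), Mono i ∧ e.obj.hom ≫ i = θ :=
  ⟨MatchingCategory.mk (factorThruImage θ) (len_image_lt θ h), image.ι θ,
    inferInstanceAs (Mono (image.ι θ)), image.fac θ⟩

/-- The projection of the matching object attached to a noninjective map. -/
def matchingExt (W : SimplexCategory ⥤ C) {n m : SimplexCategory} (θ : n ⟶ m) (h : ¬ Mono θ) :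
    matchingObj W n ⟶ W.obj m :=
  matchingπ W (exists_fac_of_not_mono θ h).choose ≫
    W.map (exists_fac_of_not_mono θ h).choose_spec.choose

/-- Here `i` need not be injective, which is what makes compatibility with composition immediate. -/
lemma matchingExt_eq (W : SimplexCategory ⥤ C) {n m : SimplexCategory} (θ : n ⟶ m)
    (h : ¬ Mono θ) (e : MatchingCategory n) (i : e.obj.right ⟶ m) (fac : e.obj.hom ≫ i = θ) :
    matchingExt W θ h = matchingπ W e ≫ W.map i := by
  have hspec := (exists_fac_of_not_mono θ h).choose_spec.choose_spec
  have := hspec.1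
  exact (matchingπ_map_eq W e _ i _ (fac.trans hspec.2.symm)).symm

lemma matchingExt_map (W : SimplexCategory ⥤ C) {n m k : SimplexCategory} (θ : n ⟶ m)
    (h : ¬ Mono θ) (g : m ⟶ k) (h' : ¬ Mono (θ ≫ g)) :
    matchingExt W θ h ≫ W.map g = matchingExt W (θ ≫ g) h' := by
  obtain ⟨e, i, _, fac⟩ := exists_fac_of_not_mono θ h
  rw [matchingExt_eq W θ h e i fac, matchingExt_eq W (θ ≫ g) h' e (i ≫ g) (by rw [reassoc_of% fac]),
    Category.assoc, W.map_comp]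

lemma matchingMap_matchingExt (W : SimplexCategory ⥤ C) {n m : SimplexCategory} (θ : n ⟶ m)
    (h : ¬ Mono θ) : matchingMap W n ≫ matchingExt W θ h = W.map θ := by
  obtain ⟨e, i, _, fac⟩ := exists_fac_of_not_mono θ h
  rw [matchingExt_eq W θ h e i fac, matchingMap_π_assoc, ← W.map_comp, fac]

end

/-! ### Attaching a cell to a cosimplicial object -/

section

variable {C : Type u} [Category.{v} C]

/-- The data needed to replace the value at `n` of a cosimplicial object `W` by an object `V`
under it, in a way that is compatible with the codegeneracies. -/
structure CellData (W : SimplexCategory ⥤ C) (n : SimplexCategory) where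
  /-- the new object -/
  V : C
  /-- the map from the old object -/
  i : W.obj n ⟶ V
  /-- the action of noninjective maps on the new object -/
  d : ∀ {m : SimplexCategory} (θ : n ⟶ m), ¬ Mono θ → (V ⟶ W.obj m)
  i_d : ∀ {m : SimplexCategory} (θ : n ⟶ m) (h : ¬ Mono θ), i ≫ d θ h = W.map θ
  d_map : ∀ {m k : SimplexCategory} (θ : n ⟶ m) (h : ¬ Mono θ) (g : m ⟶ k)
    (h' : ¬ Mono (θ ≫ g)), d θ h ≫ W.map g = d (θ ≫ g) h'

namespace CellData

variable [HasFiniteColimits C] {W : SimplexCategory ⥤ C} {n : SimplexCategory} (c : CellData W n)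

instance (n m : SimplexCategory) : Finite { θ : n ⟶ m // Mono θ } := Subtype.finite

/-- The values of the cosimplicial object obtained by attaching a cell. -/
def attachObj (m : SimplexCategory) : C :=
  -- Only injective maps contribute a copy of `V`: along noninjective maps, `V` already maps to the
  -- old values through `d`.
  pushout (Sigma.desc (fun θ : { θ : n ⟶ m // Mono θ } ↦ W.map θ.1))
    (Limits.Sigma.map (fun _ : { θ : n ⟶ m // Mono θ } ↦ c.i))

/-- The inclusion of the old values. -/
def inc (m : SimplexCategory) : W.obj m ⟶ c.attachObj m :=
  pushout.inl _ _

/-- The inclusions of the new object at the injective maps. -/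
def cell₀ {m : SimplexCategory} (θ : { θ : n ⟶ m // Mono θ }) : c.V ⟶ c.attachObj m :=
  Sigma.ι (fun _ : { θ : n ⟶ m // Mono θ } ↦ c.V) θ ≫ pushout.inr _ _

lemma i_cell₀ {m : SimplexCategory} (θ : { θ : n ⟶ m // Mono θ }) :
    c.i ≫ c.cell₀ θ = W.map θ.1 ≫ c.inc m := by
  have := Sigma.ι (fun _ : { θ : n ⟶ m // Mono θ } ↦ W.obj n) θ ≫=
    pushout.condition (f := Sigma.desc (fun θ : { θ : n ⟶ m // Mono θ } ↦ W.map θ.1))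
      (g := Limits.Sigma.map (fun _ : { θ : n ⟶ m // Mono θ } ↦ c.i))
  rw [Sigma.ι_desc_assoc, Limits.Sigma.ι_map_assoc] at this
  exact this.symm

open Classical in
/-- The inclusions of the new object at all maps. -/
def cell {m : SimplexCategory} (θ : n ⟶ m) : c.V ⟶ c.attachObj m :=
  if h : Mono θ then c.cell₀ ⟨θ, h⟩ else c.d θ h ≫ c.inc m

lemma cell_of_not_mono {m : SimplexCategory} (θ : n ⟶ m) (h : ¬ Mono θ) :
    c.cell θ = c.d θ h ≫ c.inc m :=
  dif_neg h

lemma cell_of_mono {m : SimplexCategory} (θ : n ⟶ m) (h : Mono θ) :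
    c.cell θ = c.cell₀ ⟨θ, h⟩ :=
  dif_pos h

lemma i_cell {m : SimplexCategory} (θ : n ⟶ m) : c.i ≫ c.cell θ = W.map θ ≫ c.inc m := by
  by_cases h : Mono θ
  · rw [cell_of_mono c θ h, i_cell₀]
  · rw [cell_of_not_mono c θ h, reassoc_of% c.i_d θ h]

/-- Maps out of the values of the attached cosimplicial object. -/
def desc {m : SimplexCategory} {T : C} (f : W.obj m ⟶ T) (g : ∀ θ : n ⟶ m, Mono θ → (c.V ⟶ T))
    (h : ∀ θ hθ, c.i ≫ g θ hθ = W.map θ ≫ f) : c.attachObj m ⟶ T :=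
  pushout.desc f (Sigma.desc fun θ ↦ g θ.1 θ.2) (by
    apply Sigma.hom_ext
    intro θ
    rw [Sigma.ι_desc_assoc, Limits.Sigma.ι_map_assoc, Sigma.ι_desc, h])

lemma inc_desc {m : SimplexCategory} {T : C} (f : W.obj m ⟶ T)
    (g : ∀ θ : n ⟶ m, Mono θ → (c.V ⟶ T)) (h : ∀ θ hθ, c.i ≫ g θ hθ = W.map θ ≫ f) :
    c.inc m ≫ c.desc f g h = f :=
  pushout.inl_desc _ _ _

lemma cell_desc {m : SimplexCategory} {T : C} (f : W.obj m ⟶ T)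
    (g : ∀ θ : n ⟶ m, Mono θ → (c.V ⟶ T)) (h : ∀ θ hθ, c.i ≫ g θ hθ = W.map θ ≫ f)
    (θ : n ⟶ m) (hθ : Mono θ) : c.cell θ ≫ c.desc f g h = g θ hθ := by
  rw [cell_of_mono c θ hθ]
  refine (Category.assoc _ _ _).trans ?_
  refine (congrArg (Sigma.ι (fun _ : { θ : n ⟶ m // Mono θ } ↦ c.V) ⟨θ, hθ⟩ ≫ ·)
    (pushout.inr_desc _ _ _)).trans ?_
  exact Sigma.ι_desc _ _

lemma attachObj_hom_ext {m : SimplexCategory} {T : C} {f g : c.attachObj m ⟶ T}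
    (h : c.inc m ≫ f = c.inc m ≫ g) (h' : ∀ θ : n ⟶ m, Mono θ → c.cell θ ≫ f = c.cell θ ≫ g) :
    f = g := by
  apply pushout.hom_ext
  · exact h
  · apply Sigma.hom_ext
    intro θ
    have := h' θ.1 θ.2
    rw [cell_of_mono c θ.1 θ.2] at this
    exact (Category.assoc _ _ _).symm.trans (this.trans (Category.assoc _ _ _))

/-- The action of maps on the values of the attached cosimplicial object. -/
def attachMap {m k : SimplexCategory} (g : m ⟶ k) : c.attachObj m ⟶ c.attachObj k :=
  c.desc (W.map g ≫ c.inc k) (fun θ _ ↦ c.cell (θ ≫ g))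
    (fun θ _ ↦ by rw [i_cell, W.map_comp, Category.assoc])

lemma inc_attachMap {m k : SimplexCategory} (g : m ⟶ k) :
    c.inc m ≫ c.attachMap g = W.map g ≫ c.inc k :=
  c.inc_desc _ _ _

lemma inc_attachMap_assoc {m l : SimplexCategory} (g : m ⟶ l)
    {T' : C} (k : c.attachObj l ⟶ T') :
    c.inc m ≫ c.attachMap g ≫ k = W.map g ≫ c.inc l ≫ k :=
  (Category.assoc _ _ _).symm.trans ((congrArg (· ≫ k) (c.inc_attachMap g)).trans (Category.assoc _ _ _))

lemma cell_attachMap {m k : SimplexCategory} (θ : n ⟶ m) (g : m ⟶ k) :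
    c.cell θ ≫ c.attachMap g = c.cell (θ ≫ g) := by
  by_cases h : Mono θ
  · exact c.cell_desc _ _ _ θ h
  · have h' : ¬ Mono (θ ≫ g) := fun _ ↦ h (mono_of_mono θ g)
    rw [cell_of_not_mono c θ h, cell_of_not_mono c _ h', Category.assoc, inc_attachMap,
      reassoc_of% c.d_map θ h g h']

lemma cell_attachMap_assoc {m l : SimplexCategory} (θ : n ⟶ m) (g : m ⟶ l)
    {T' : C} (k : c.attachObj l ⟶ T') :
    c.cell θ ≫ c.attachMap g ≫ k = c.cell (θ ≫ g) ≫ k :=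
  (Category.assoc _ _ _).symm.trans (congrArg (· ≫ k) (c.cell_attachMap θ g))

/-- The cosimplicial object obtained by attaching a cell. -/
def attach : SimplexCategory ⥤ C where
  obj := c.attachObj
  map := c.attachMap
  map_id m := by
    apply c.attachObj_hom_ext
    · rw [inc_attachMap, W.map_id, Category.id_comp, Category.comp_id]
    · intro θ _
      rw [cell_attachMap, Category.comp_id, Category.comp_id]
  map_comp g g' := by
    apply c.attachObj_hom_ext
    · rw [inc_attachMap, inc_attachMap_assoc, inc_attachMap, W.map_comp, Category.assoc]
    · intro θ _
      rw [cell_attachMap, cell_attachMap_assoc, cell_attachMap, Category.assoc]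

/-- The inclusion of the old cosimplicial object. -/
def toAttach : W ⟶ c.attach where
  app := c.inc
  naturality _ _ g := (c.inc_attachMap g).symm

/-- The inclusion of the new object in the attached cosimplicial object at a map. -/
def attachCell {m : SimplexCategory} (θ : n ⟶ m) : c.V ⟶ c.attach.obj m :=
  c.cell θ

/-- Maps out of the attached cosimplicial object in a given degree. -/
def attachDesc {m : SimplexCategory} {T : C} (f : W.obj m ⟶ T)
    (g : ∀ θ : n ⟶ m, Mono θ → (c.V ⟶ T))
    (h : ∀ θ hθ, c.i ≫ g θ hθ = W.map θ ≫ f) : c.attach.obj m ⟶ T :=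
  c.desc f g h

lemma i_attachCell {m : SimplexCategory} (θ : n ⟶ m) :
    c.i ≫ c.attachCell θ = W.map θ ≫ c.toAttach.app m :=
  c.i_cell θ

lemma i_attachCell_assoc {m : SimplexCategory} (θ : n ⟶ m)
    {T' : C} (k : c.attach.obj m ⟶ T') :
    c.i ≫ c.attachCell θ ≫ k = W.map θ ≫ c.toAttach.app m ≫ k :=
  (Category.assoc _ _ _).symm.trans ((congrArg (· ≫ k) (c.i_attachCell θ)).trans (Category.assoc _ _ _))

lemma toAttach_attachDesc {m : SimplexCategory} {T : C} (f : W.obj m ⟶ T)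
    (g : ∀ θ : n ⟶ m, Mono θ → (c.V ⟶ T)) (h : ∀ θ hθ, c.i ≫ g θ hθ = W.map θ ≫ f) :
    c.toAttach.app m ≫ c.attachDesc f g h = f :=
  c.inc_desc _ _ _

lemma toAttach_attachDesc_assoc {m : SimplexCategory} {T : C} (f : W.obj m ⟶ T)
    (g : ∀ θ : n ⟶ m, Mono θ → (c.V ⟶ T)) (h : ∀ θ hθ, c.i ≫ g θ hθ = W.map θ ≫ f)
    {T' : C} (k : T ⟶ T') :
    c.toAttach.app m ≫ c.attachDesc f g h ≫ k = f ≫ k :=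
  (Category.assoc _ _ _).symm.trans (congrArg (· ≫ k) (c.toAttach_attachDesc f g h))

lemma attachCell_attachDesc {m : SimplexCategory} {T : C} (f : W.obj m ⟶ T)
    (g : ∀ θ : n ⟶ m, Mono θ → (c.V ⟶ T)) (h : ∀ θ hθ, c.i ≫ g θ hθ = W.map θ ≫ f)
    (θ : n ⟶ m) (hθ : Mono θ) : c.attachCell θ ≫ c.attachDesc f g h = g θ hθ :=
  c.cell_desc _ _ _ _ _

lemma attachCell_attachDesc_assoc {m : SimplexCategory} {T : C} (f : W.obj m ⟶ T)
    (g : ∀ θ : n ⟶ m, Mono θ → (c.V ⟶ T)) (h : ∀ θ hθ, c.i ≫ g θ hθ = W.map θ ≫ f)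
    (θ : n ⟶ m) (hθ : Mono θ)
    {T' : C} (k : T ⟶ T') :
    c.attachCell θ ≫ c.attachDesc f g h ≫ k = g θ hθ ≫ k :=
  (Category.assoc _ _ _).symm.trans (congrArg (· ≫ k) (c.attachCell_attachDesc f g h θ hθ))

lemma attach_hom_ext {m : SimplexCategory} {T : C} {f g : c.attach.obj m ⟶ T}
    (h : c.toAttach.app m ≫ f = c.toAttach.app m ≫ g)
    (h' : ∀ θ : n ⟶ m, Mono θ → c.attachCell θ ≫ f = c.attachCell θ ≫ g) : f = g :=
  c.attachObj_hom_ext h h'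

lemma attachCell_map {m k : SimplexCategory} (θ : n ⟶ m) (g : m ⟶ k) :
    c.attachCell θ ≫ c.attach.map g = c.attachCell (θ ≫ g) :=
  c.cell_attachMap θ g

lemma attachCell_map_assoc {m l : SimplexCategory} (θ : n ⟶ m) (g : m ⟶ l)
    {T' : C} (k : c.attach.obj l ⟶ T') :
    c.attachCell θ ≫ c.attach.map g ≫ k = c.attachCell (θ ≫ g) ≫ k :=
  (Category.assoc _ _ _).symm.trans (congrArg (· ≫ k) (c.attachCell_map θ g))

lemma attachCell_of_not_mono {m : SimplexCategory} (θ : n ⟶ m) (h : ¬ Mono θ) :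
    c.attachCell θ = c.d θ h ≫ c.toAttach.app m :=
  c.cell_of_not_mono θ h

/-- There is no injection from `n` to a shorter ordinal, so nothing is attached below degree `n`. -/
lemma isIso_toAttach_app {m : SimplexCategory} (h : m.len < n.len) : IsIso (c.toAttach.app m) := by
  have hm (θ : n ⟶ m) : ¬ Mono θ := fun _ ↦ h.not_ge (SimplexCategory.len_le_of_mono θ)
  refine ⟨c.attachDesc (𝟙 _) (fun θ hθ ↦ absurd hθ (hm θ)) (fun θ hθ ↦ absurd hθ (hm θ)),
    c.toAttach_attachDesc _ _ _, ?_⟩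
  apply c.attach_hom_ext
  · rw [toAttach_attachDesc_assoc, Category.id_comp, Category.comp_id]
  · exact fun θ hθ ↦ absurd hθ (hm θ)

/-- The only injection from `n` to itself is the identity, so in degree `n` the old value is simply
replaced by `V`. -/
lemma isIso_attachCell_id : IsIso (c.attachCell (𝟙 n)) := by
  have hid (θ : n ⟶ n) (_ : Mono θ) : θ = 𝟙 n := SimplexCategory.eq_id_of_mono θ
  refine ⟨c.attachDesc c.i (fun _ _ ↦ 𝟙 _) (fun θ hθ ↦ ?_), ?_, ?_⟩
  · rw [hid θ hθ, W.map_id, Category.id_comp, Category.comp_id]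
  · exact c.attachCell_attachDesc _ _ _ _ inferInstance
  · apply c.attach_hom_ext
    · rw [toAttach_attachDesc_assoc, Category.comp_id, i_attachCell, W.map_id, Category.id_comp]
    · intro θ hθ
      rw [attachCell_attachDesc_assoc c _ _ _ θ hθ, Category.id_comp, Category.comp_id, hid θ hθ]

/-- Attaching a cell along a map with a left lifting property is a Reedy map with the same
lifting property. -/
lemma hasLiftingProperty_relativeLatchingMap {E S : C} (q : E ⟶ S)
    (hi : HasLiftingProperty c.i q) (m : SimplexCategory) :
    HasLiftingProperty (relativeLatchingMap c.toAttach m) q := by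
  rw [hasLiftingProperty_relativeLatchingMap_iff]
  intro u w z h₁ h₂ h₃
  have h₁' (j : LatchingCategory m) :
      c.toAttach.app j.obj.left ≫ latchingι c.attach j ≫ w = W.map j.obj.hom ≫ u := by
    have := latchingι W j ≫= h₁
    rwa [ι_latchingObjMap_assoc, ι_latchingMap_assoc] at this
  have h₂' (j : LatchingCategory m) :
      latchingι c.attach j ≫ w ≫ q = c.attach.map j.obj.hom ≫ z := by
    have := latchingι c.attach j ≫= h₂
    rw [ι_latchingMap_assoc] at this
    exact this.symm
  have h₃' : c.toAttach.app m ≫ z = u ≫ q := h₃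
  have ex (θ : n ⟶ m) (hθ : Mono θ) : ∃ g : c.V ⟶ E, c.i ≫ g = W.map θ ≫ u ∧
      g ≫ q = c.attachCell θ ≫ z ∧ ∀ (j : LatchingCategory m) (θ' : n ⟶ j.obj.left),
        θ' ≫ j.obj.hom = θ → g = c.attachCell θ' ≫ latchingι c.attach j ≫ w := by
    -- If `n < m`, then `θ` is a proper face of `m` and the value on its copy of `V` is forced by
    -- `w`. Otherwise no proper face contains `θ`, and the lifting property of `c.i` supplies the
    -- value.
    by_cases hnm : n.len < m.len
    · let jθ : LatchingCategory m := ⟨Over.mk θ, hθ, hnm⟩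
      let cθ : c.attach.obj n ⟶ latchingObj c.attach m := latchingι c.attach jθ
      refine ⟨c.attachCell (𝟙 n) ≫ cθ ≫ w, ?_, ?_, ?_⟩
      · rw [i_attachCell_assoc, W.map_id, Category.id_comp]
        exact h₁' jθ
      · rw [Category.assoc, Category.assoc, h₂' jθ]
        have := c.attachCell_map_assoc (𝟙 n) θ z
        rwa [Category.id_comp] at this
      · intro j θ' hθ'
        let f : jθ ⟶ j := ObjectProperty.homMk (Over.homMk θ' hθ')
        have hf : c.attach.map θ' ≫ latchingι c.attach j = cθ := latchingι_w c.attach f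
        rw [← hf, Category.assoc, attachCell_map_assoc, Category.id_comp]
    · have sq : CommSq (W.map θ ≫ u) c.i q (c.attachCell θ ≫ z) := ⟨by
        rw [i_attachCell_assoc, Category.assoc, h₃']⟩
      refine ⟨sq.lift, sq.fac_left, sq.fac_right, fun j θ' hθ' ↦ ?_⟩
      have : Mono (θ' ≫ j.obj.hom) := hθ' ▸ hθ
      have := mono_of_mono θ' j.obj.hom
      exact absurd ((SimplexCategory.len_le_of_mono θ').trans_lt j.len_lt) hnm
  choose g hg₁ hg₂ hg₃ using ex
  refine ⟨c.attachDesc u g hg₁, ?_, c.toAttach_attachDesc _ _ _, ?_⟩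
  · refine latchingObj_hom_ext fun j ↦ ?_
    rw [ι_latchingMap_assoc]
    apply c.attach_hom_ext
    · rw [← c.toAttach.naturality_assoc, toAttach_attachDesc, h₁']
    · intro θ hθ
      rw [attachCell_map_assoc]
      have := j.property.1
      rw [attachCell_attachDesc c _ _ _ _ (mono_comp θ j.obj.hom)]
      exact hg₃ _ _ j θ rfl
  · apply c.attach_hom_ext
    · rw [toAttach_attachDesc_assoc, h₃']
    · intro θ hθ
      rw [attachCell_attachDesc_assoc c _ _ _ θ hθ, hg₂]

end CellData

end

/-- The inverses of invertible components of a natural transformation are natural. -/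
lemma inv_app_comp_map {J D : Type*} [Category J] [Category D] {W W' : J ⥤ D} (φ : W ⟶ W')
    {m k : J} (f : m ⟶ k) [IsIso (φ.app m)] [IsIso (φ.app k)] :
    inv (φ.app m) ≫ W.map f = W'.map f ≫ inv (φ.app k) := by
  rw [IsIso.inv_comp_eq, ← φ.naturality_assoc, IsIso.hom_inv_id, Category.comp_id]

/-! ### Composition of Reedy lifting properties -/

section

variable {C : Type u} [Category.{v} C] [HasFiniteColimits C]

lemma latchingObjMap_comp {A B D : SimplexCategory ⥤ C} (f : A ⟶ B) (g : B ⟶ D)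
    (n : SimplexCategory) :
    latchingObjMap (f ≫ g) n = latchingObjMap f n ≫ latchingObjMap g n :=
  latchingObj_hom_ext fun j ↦ by
    rw [ι_latchingObjMap, ι_latchingObjMap_assoc, ι_latchingObjMap, NatTrans.comp_app,
      Category.assoc]

lemma latchingObjMap_comp_assoc {A B D : SimplexCategory ⥤ C} (f : A ⟶ B) (g : B ⟶ D)
    (n : SimplexCategory)
    {T' : C} (k : latchingObj D n ⟶ T') :
    latchingObjMap (f ≫ g) n ≫ k = latchingObjMap f n ≫ latchingObjMap g n ≫ k :=
  (congrArg (· ≫ k) (latchingObjMap_comp f g n)).trans (Category.assoc _ _ _)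

/-- A lift for `f` is found first and then serves as the prescribed restriction in the lifting
problem for `g`. -/
lemma hasLiftingProperty_relativeLatchingMap_comp {A B D : SimplexCategory ⥤ C} (f : A ⟶ B)
    (g : B ⟶ D) (n : SimplexCategory) {E S : C} (q : E ⟶ S)
    (hf : HasLiftingProperty (relativeLatchingMap f n) q)
    (hg : HasLiftingProperty (relativeLatchingMap g n) q) :
    HasLiftingProperty (relativeLatchingMap (f ≫ g) n) q := by
  rw [hasLiftingProperty_relativeLatchingMap_iff] at hf hg ⊢
  intro u w z h₁ h₂ h₃
  rw [latchingObjMap_comp, Category.assoc] at h₁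
  rw [NatTrans.comp_app, Category.assoc] at h₃
  obtain ⟨l, hl₁, hl₂, hl₃⟩ := hf u (latchingObjMap g n ≫ w) (g.app n ≫ z) h₁ (by
    rw [← Category.assoc, ← latchingObjMap_comp_latchingMap, Category.assoc, h₂,
      Category.assoc]) h₃
  obtain ⟨l', hl₁', hl₂', hl₃'⟩ := hg l w z hl₁.symm h₂ hl₃.symm
  exact ⟨l', hl₁', by rw [NatTrans.comp_app, Category.assoc, hl₂', hl₂], hl₃'⟩

lemma hasLiftingProperty_relativeLatchingMap_of_isIso {A B : SimplexCategory ⥤ C} (f : A ⟶ B)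
    (n : SimplexCategory) {E S : C} (q : E ⟶ S)
    (hf : ∀ m : SimplexCategory, m.len ≤ n.len → IsIso (f.app m)) :
    HasLiftingProperty (relativeLatchingMap f n) q := by
  rw [hasLiftingProperty_relativeLatchingMap_iff]
  intro u w z h₁ h₂ h₃
  have := hf n le_rfl
  refine ⟨inv (f.app n) ≫ u, ?_, by simp, by simp [← h₃]⟩
  refine latchingObj_hom_ext fun j ↦ ?_
  have := hf j.obj.left j.len_lt.le
  have h := latchingι A j ≫= h₁
  rw [ι_latchingObjMap_assoc, ι_latchingMap_assoc] at h
  rw [ι_latchingMap_assoc, ← cancel_epi (f.app j.obj.left), h, ← f.naturality_assoc,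
    IsIso.hom_inv_id_assoc]

end

section

variable {C : Type u} [Category.{v} C] [ModelCategory C]

/-- Closure of Reedy cofibrations under composition and pushout is thereby reduced to solving
lifting problems. -/
lemma isReedyCofibration_iff {A B : SimplexCategory ⥤ C} (f : A ⟶ B) :
    IsReedyCofibration f ↔ ∀ (n : SimplexCategory) {E S : C} (q : E ⟶ S),
      trivialFibrations C q → HasLiftingProperty (relativeLatchingMap f n) q := by
  have h (n : SimplexCategory) : Cofibration (relativeLatchingMap f n) ↔
      (trivialFibrations C).llp (relativeLatchingMap f n) := by
    rw [trivialFibrations_llp, cofibration_iff]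
  exact forall_congr' h

lemma IsReedyCofibration.comp {A B D : SimplexCategory ⥤ C} {f : A ⟶ B} {g : B ⟶ D}
    (hf : IsReedyCofibration f) (hg : IsReedyCofibration g) : IsReedyCofibration (f ≫ g) := by
  rw [isReedyCofibration_iff] at hf hg ⊢
  exact fun n _ _ q hq ↦
    hasLiftingProperty_relativeLatchingMap_comp f g n q (hf n q hq) (hg n q hq)

/-! ### Matching maps with the lifting property against cofibrations -/

/-- The map from `W` in degree `n` to its matching object has the right lifting property against
cofibrations. -/
def MatchingLifts (W : SimplexCategory ⥤ C) (n : SimplexCategory) : Prop :=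
  ∀ ⦃K L : C⦄ (i : K ⟶ L) [Cofibration i] (u : K ⟶ W.obj n)
    (z : ∀ e : MatchingCategory n, L ⟶ W.obj e.obj.right),
    (∀ ⦃e e' : MatchingCategory n⦄ (f : e ⟶ e'), z e ≫ W.map f.hom.right = z e') →
    (∀ e, i ≫ z e = u ≫ W.map e.obj.hom) →
    ∃ l : L ⟶ W.obj n, i ≫ l = u ∧ ∀ e : MatchingCategory n, l ≫ W.map e.obj.hom = z e

/-- The condition involves degrees at most `n` only, so it passes from a stage of the tower to the
colimit. -/
lemma MatchingLifts.of_isIso {W W' : SimplexCategory ⥤ C} (φ : W ⟶ W') {n : SimplexCategory}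
    (hφ : ∀ m : SimplexCategory, m.len ≤ n.len → IsIso (φ.app m)) (h : MatchingLifts W n) :
    MatchingLifts W' n := by
  intro K L i _ u z hz hu
  have := hφ n le_rfl
  have (e : MatchingCategory n) : IsIso (φ.app e.obj.right) := hφ _ e.len_lt.le
  obtain ⟨l, hl, hl'⟩ := h i (u ≫ inv (φ.app n)) (fun e ↦ z e ≫ inv (φ.app e.obj.right))
    (fun e e' f ↦ by
      rw [← hz f, Category.assoc, Category.assoc, inv_app_comp_map φ])
    (fun e ↦ by
      rw [reassoc_of% hu e, Category.assoc, inv_app_comp_map φ])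
  refine ⟨l ≫ φ.app n, by rw [reassoc_of% hl]; simp, fun e ↦ ?_⟩
  rw [Category.assoc, ← φ.naturality, reassoc_of% hl' e]
  simp

/-- If the matching maps in positive degrees have the right lifting property against cofibrations,
so have the maps to degree zero. -/
lemma hasLiftingProperty_map_of_matchingLifts {W : SimplexCategory ⥤ C}
    (hW : ∀ n : SimplexCategory, 0 < n.len → MatchingLifts W n) (n : SimplexCategory)
    (hn : 0 < n.len) (t : n ⟶ ⦋0⦌) {K L : C} (i : K ⟶ L) [Cofibration i] :
    HasLiftingProperty i (W.map t) := by
  refine ⟨fun {u z} sq ↦ ?_⟩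
  have tt {k : SimplexCategory} (a b : k ⟶ ⦋0⦌) : a = b := Subsingleton.elim _ _
  let pr (k : SimplexCategory) : k ⟶ ⦋0⦌ := SimplexCategory.const k ⦋0⦌ 0
  have epi_pr (k : SimplexCategory) : Epi (pr k) :=
    SimplexCategory.epi_iff_surjective.2 fun x ↦ ⟨0, Subsingleton.elim (α := Fin 1) _ _⟩
  obtain ⟨s, hs⟩ := exists_compatible_section (I := MatchingCategory n)
    (fun e ↦ e.obj.right.len) n.len (fun e ↦ e.len_lt) MatchingCategory.len_lt_or_eq
    (fun e ↦ { l : L ⟶ W.obj e.obj.right //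
      i ≫ l = u ≫ W.map e.obj.hom ∧ l ≫ W.map (pr _) = z })
    (fun {e e'} f l ↦ ⟨l.1 ≫ W.map f.hom.right, by
      rw [reassoc_of% l.2.1, ← W.map_comp, Under.w], by
      rw [Category.assoc, ← W.map_comp, tt (f.hom.right ≫ pr _) (pr _), l.2.2]⟩)
    (fun e l ↦ Subtype.ext (by
      change l.1 ≫ W.map (𝟙 _) = l.1
      simp))
    (fun e s hs ↦ by
      -- On a quotient of degree zero the lift is forced by `z`; on the others it comes from the
      -- matching condition, relative to the lifts on further quotients.
      obtain h₀ | h₀ := Nat.eq_zero_or_pos e.obj.right.len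
      · have : IsIso (pr e.obj.right) := by
          have h : Mono (pr e.obj.right) := SimplexCategory.mono_iff_injective.2 (by
            have : Subsingleton (Fin (e.obj.right.len + 1)) := by
              rw [h₀]
              exact inferInstanceAs (Subsingleton (Fin 1))
            exact Function.injective_of_subsingleton _)
          exact isIso_of_mono_of_epi _
        refine ⟨⟨z ≫ inv (W.map (pr e.obj.right)), ?_, by simp⟩, fun j _ hj ↦ ?_⟩
        · rw [← reassoc_of% sq.w, tt t (e.obj.hom ≫ pr _)]
          simp
        · exact absurd hj (by omega)
      · obtain ⟨x, hx⟩ : ∃ x : ∀ j : MatchingCategory e.obj.right, L ⟶ W.obj j.obj.right,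
            ∀ j, x j = (s (e.comp j) (e.compHom j) j.len_lt).1 := ⟨_, fun _ ↦ rfl⟩
        have hcomp (j : MatchingCategory e.obj.right) (k : MatchingCategory n)
            (g : e.comp j ⟶ k) (hk : k.obj.right.len < e.obj.right.len) :
            x j ≫ W.map g.hom.right = (s k (e.compHom j ≫ g) hk).1 := by
          rw [hx]
          exact congrArg Subtype.val (hs _ _ (e.compHom j) g j.len_lt hk)
        obtain ⟨l, hl₁, hl₂⟩ := hW e.obj.right h₀ i (u ≫ W.map e.obj.hom) x
          (fun j k g ↦ by
            let g' : e.comp j ⟶ e.comp k := ObjectProperty.homMk (Under.homMk g.hom.right (by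
              change (e.obj.hom ≫ j.obj.hom) ≫ g.hom.right = e.obj.hom ≫ k.obj.hom
              rw [Category.assoc, Under.w]))
            refine (hcomp j _ g' k.len_lt).trans ?_
            have : e.compHom j ≫ g' = e.compHom k := by
              ext1
              exact Under.UnderMorphism.ext (Under.w g.hom)
            rw [this, hx])
          (fun j ↦ by
            rw [hx]
            refine (s (e.comp j) (e.compHom j) j.len_lt).2.1.trans ?_
            rw [Category.assoc, ← W.map_comp]
            rfl)
        refine ⟨⟨l, hl₁, ?_⟩, fun j g hj ↦ Subtype.ext ?_⟩
        · have := epi_pr e.obj.right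
          let j : MatchingCategory e.obj.right := MatchingCategory.mk (pr e.obj.right) h₀
          refine (hl₂ j).trans ?_
          have h := (s (e.comp j) (e.compHom j) j.len_lt).2.2
          rw [← hx] at h
          have h' : W.map (pr (e.comp j).obj.right) = 𝟙 _ := by
            rw [← W.map_id]
            exact congrArg W.map (tt (pr ⦋0⦌) (𝟙 ⦋0⦌))
          rw [h'] at h
          exact (Category.comp_id _).symm.trans h
        · let j' : MatchingCategory e.obj.right :=
            ⟨Under.mk g.hom.right, MatchingCategory.epi_right g, hj⟩
          let g' : e.comp j' ⟶ j := ObjectProperty.homMk (Under.homMk (𝟙 _) (by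
            refine (Category.comp_id _).trans ?_
            exact Under.w g.hom))
          have h₅ : x j' ≫ W.map (𝟙 _) = (s j (e.compHom j' ≫ g') hj).1 := hcomp j' j g' hj
          have h₆ : e.compHom j' ≫ g' = g := by
            ext1
            exact Under.UnderMorphism.ext (Category.comp_id _)
          rw [W.map_id, Category.comp_id, h₆] at h₅
          rw [← h₅]
          exact hl₂ j')
  obtain ⟨l, hl₁, hl₂⟩ := hW n hn i u (fun e ↦ (s e).1)
    (fun e e' f ↦ congrArg Subtype.val (hs e e' f)) (fun e ↦ (s e).2.1)
  refine ⟨⟨⟨l, hl₁, ?_⟩⟩⟩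
  have := epi_pr n
  -- As `n` has positive degree, its projection to `⦋0⦌` is one of the proper quotients, so
  -- compatibility with `z` is part of the matching condition.
  let j : MatchingCategory n := MatchingCategory.mk (pr n) hn
  have h := (s j).2.2
  have h' : W.map (pr j.obj.right) = 𝟙 _ := by
    rw [← W.map_id]
    exact congrArg W.map (tt (pr ⦋0⦌) (𝟙 ⦋0⦌))
  rw [tt t (pr n)]
  refine (hl₂ j).trans (Eq.trans ?_ h)
  exact (Category.comp_id _).symm.trans (congrArg ((s j).1 ≫ ·) h'.symm)

end

/-! ### Replacing matching maps by trivial fibrations -/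

section

variable {C : Type u} [Category.{v} C] [ModelCategory C]

/-- The cell that replaces the matching map of `W` at `n` by a trivial fibration. -/
def matchingCell (W : SimplexCategory ⥤ C) (n : SimplexCategory) : CellData W n :=
  let h := MorphismProperty.factorizationData (cofibrations C) (trivialFibrations C)
    (matchingMap W n)
  { V := h.Z
    i := h.i
    d := fun θ hθ ↦ h.p ≫ matchingExt W θ hθ
    i_d := fun θ hθ ↦ by rw [h.fac_assoc, matchingMap_matchingExt]
    d_map := fun θ hθ g hg ↦ by rw [Category.assoc, matchingExt_map W θ hθ g hg] }

/-- The trivial fibration from the new object to the matching object. -/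
def matchingCellMap (W : SimplexCategory ⥤ C) (n : SimplexCategory) :
    (matchingCell W n).V ⟶ matchingObj W n :=
  (MorphismProperty.factorizationData (cofibrations C) (trivialFibrations C)
    (matchingMap W n)).p

lemma trivialFibrations_matchingCellMap (W : SimplexCategory ⥤ C) (n : SimplexCategory) :
    trivialFibrations C (matchingCellMap W n) :=
  (MorphismProperty.factorizationData (cofibrations C) (trivialFibrations C)
    (matchingMap W n)).hp

lemma cofibration_matchingCell_i (W : SimplexCategory ⥤ C) (n : SimplexCategory) :
    Cofibration (matchingCell W n).i :=
  (cofibration_iff _).2 (MorphismProperty.factorizationData (cofibrations C)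
    (trivialFibrations C) (matchingMap W n)).hi

lemma matchingCell_d (W : SimplexCategory ⥤ C) {n m : SimplexCategory} (θ : n ⟶ m)
    (h : ¬ Mono θ) : (matchingCell W n).d θ h = matchingCellMap W n ≫ matchingExt W θ h :=
  rfl

lemma isReedyCofibration_toAttach_matchingCell (W : SimplexCategory ⥤ C) (n : SimplexCategory) :
    IsReedyCofibration (matchingCell W n).toAttach := by
  rw [isReedyCofibration_iff]
  intro m E S q hq
  apply (matchingCell W n).hasLiftingProperty_relativeLatchingMap
  rw [mem_trivialFibrations_iff] at hq
  obtain ⟨_, _⟩ := hq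
  have := cofibration_matchingCell_i W n
  infer_instance

/-- Degree `n` is now `V` and lower degrees are unchanged, so the matching map has become the
trivial fibration `matchingCellMap W n`. -/
lemma matchingLifts_attach_matchingCell (W : SimplexCategory ⥤ C) (n : SimplexCategory) :
    MatchingLifts (matchingCell W n).attach n := by
  intro K L i _ u z hz hu
  have hfib := trivialFibrations_matchingCellMap W n
  rw [mem_trivialFibrations_iff] at hfib
  obtain ⟨_, _⟩ := hfib
  have hmap {m : SimplexCategory} (θ : n ⟶ m) (h : ¬ Mono θ) := matchingCell_d W θ h
  generalize matchingCellMap W n = q at *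
  generalize matchingCell W n = c at *
  have := c.isIso_attachCell_id
  have (e : MatchingCategory n) : IsIso (c.toAttach.app e.obj.right) :=
    c.isIso_toAttach_app e.len_lt
  have hcell (e : MatchingCategory n) : c.attachCell (𝟙 n) ≫ c.attach.map e.obj.hom =
      q ≫ matchingπ W e ≫ c.toAttach.app e.obj.right := by
    have he : ¬ Mono e.obj.hom := fun _ ↦
      e.len_lt.not_ge (SimplexCategory.len_le_of_mono e.obj.hom)
    rw [c.attachCell_map, Category.id_comp, c.attachCell_of_not_mono _ he, hmap,
      matchingExt_eq W _ he e (𝟙 _) (Category.comp_id _), W.map_id, Category.comp_id,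
      Category.assoc]
  have sq : CommSq (u ≫ inv (c.attachCell (𝟙 n))) i q
      (matchingLift (fun e ↦ z e ≫ inv (c.toAttach.app e.obj.right)) (fun e e' f ↦ by
        rw [← hz f, Category.assoc, Category.assoc, inv_app_comp_map c.toAttach])) := ⟨by
    refine matchingObj_hom_ext fun e ↦ ?_
    rw [Category.assoc, Category.assoc, Category.assoc, matchingLift_π, reassoc_of% hu e,
      ← cancel_mono (c.toAttach.app e.obj.right)]
    simp only [Category.assoc, IsIso.inv_hom_id, Category.comp_id]
    rw [← hcell, IsIso.inv_hom_id_assoc]⟩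
  refine ⟨sq.lift ≫ c.attachCell (𝟙 n), ?_, fun e ↦ ?_⟩
  · rw [← Category.assoc, sq.fac_left, Category.assoc, IsIso.inv_hom_id, Category.comp_id]
  · rw [Category.assoc, hcell, ← Category.assoc, sq.fac_right, ← Category.assoc, matchingLift_π,
      Category.assoc, IsIso.inv_hom_id, Category.comp_id]

/-- The sequence of cosimplicial objects whose matching maps are successively replaced by trivial
fibrations. -/
def matchingTower (P : SimplexCategory ⥤ C) (k : ℕ) : SimplexCategory ⥤ C :=
  -- Step `k` treats degree `k + 1`: degree zero is never changed, and degree `m` is stable from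
  -- stage `m` on.
  Nat.rec P (fun k W ↦ (matchingCell W ⦋k + 1⦌).attach) k

/-- The transition maps of the sequence. -/
def matchingTowerStep (P : SimplexCategory ⥤ C) (k : ℕ) :
    matchingTower P k ⟶ matchingTower P (k + 1) :=
  (matchingCell (matchingTower P k) ⦋k + 1⦌).toAttach

/-- The sequence, as a functor. -/
def matchingTowerFunctor (P : SimplexCategory ⥤ C) : ℕ ⥤ (SimplexCategory ⥤ C) :=
  Functor.ofSequence (matchingTowerStep P)

lemma isIso_matchingTowerFunctor_map (P : SimplexCategory ⥤ C) (m : SimplexCategory) {a b : ℕ}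
    (f : a ⟶ b) (ha : m.len ≤ a) : IsIso (((matchingTowerFunctor P).map f).app m) := by
  obtain ⟨h⟩ : Nonempty (a ≤ b) := ⟨leOfHom f⟩
  obtain rfl : f = homOfLE h := Subsingleton.elim _ _
  induction b, h using Nat.le_induction with
  | base =>
    have : homOfLE (le_refl a) = 𝟙 a := rfl
    rw [this, CategoryTheory.Functor.map_id]
    infer_instance
  | succ b h ih =>
    have hfac : homOfLE (h.trans (Nat.le_succ b)) = homOfLE h ≫ homOfLE (Nat.le_succ b) := rfl
    rw [hfac, Functor.map_comp, NatTrans.comp_app]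
    have h' : IsIso (((matchingTowerFunctor P).map (homOfLE (Nat.le_succ b))).app m) := by
      have hstep : (matchingTowerFunctor P).map (homOfLE (Nat.le_succ b)) =
          matchingTowerStep P b := Functor.ofSequence_map_homOfLE_succ _ b
      rw [hstep]
      exact CellData.isIso_toAttach_app _ (Nat.lt_succ_of_le (ha.trans h))
    infer_instance

lemma hasLiftingProperty_matchingTowerFunctor_map (P : SimplexCategory ⥤ C) (b : ℕ)
    (m : SimplexCategory) {E S : C} (q : E ⟶ S) (hq : trivialFibrations C q) :
    HasLiftingProperty
      (relativeLatchingMap ((matchingTowerFunctor P).map (homOfLE (Nat.zero_le b))) m) q := by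
  induction b with
  | zero =>
    refine hasLiftingProperty_relativeLatchingMap_of_isIso _ _ _ fun k _ ↦ ?_
    have : homOfLE (Nat.zero_le 0) = 𝟙 0 := rfl
    rw [this, CategoryTheory.Functor.map_id]
    infer_instance
  | succ b ih =>
    have hfac : homOfLE (Nat.zero_le (b + 1)) =
        homOfLE (Nat.zero_le b) ≫ homOfLE (Nat.le_succ b) := rfl
    rw [hfac, Functor.map_comp]
    refine hasLiftingProperty_relativeLatchingMap_comp _ _ _ _ ih ?_
    have hstep : (matchingTowerFunctor P).map (homOfLE (Nat.le_succ b)) =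
        matchingTowerStep P b := Functor.ofSequence_map_homOfLE_succ _ b
    rw [hstep]
    exact (isReedyCofibration_iff _).1 (isReedyCofibration_toAttach_matchingCell _ _) m q hq

/-- Every cosimplicial object has a Reedy cofibration, that is an isomorphism in degree zero, to a
cosimplicial object whose matching maps in positive degrees are trivial fibrations. -/
theorem exists_isReedyCofibration_matchingLifts (P : SimplexCategory ⥤ C) :
    ∃ (W : SimplexCategory ⥤ C) (j : P ⟶ W), IsReedyCofibration j ∧ IsIso (j.app ⦋0⦌) ∧
      ∀ n : SimplexCategory, 0 < n.len → MatchingLifts W n := by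
  let F := matchingTowerFunctor P
  -- In each degree the sequence is eventually constant, so the colimit exists although only finite
  -- colimits are assumed in `C`.
  have hconst (m : SimplexCategory) : (F.flip.obj m).IsEventuallyConstantFrom m.len :=
    fun _ f ↦ isIso_matchingTowerFunctor_map P m f le_rfl
  have (m : SimplexCategory) : HasColimit (F.flip.obj m) := (hconst m).hasColimit
  have hι (k : ℕ) (m : SimplexCategory) (h : m.len ≤ k) : IsIso ((colimit.ι F k).app m) :=
    (hconst m).isIso_ι_of_isColimit'
      (isColimitOfPreserves ((evaluation _ _).obj m) (colimit.isColimit F)) k (homOfLE h)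
  refine ⟨colimit F, colimit.ι F 0, ?_, hι 0 _ le_rfl, fun n hn ↦ ?_⟩
  · refine (isReedyCofibration_iff (A := F.obj 0) (colimit.ι F 0)).2 fun n E S q hq ↦ ?_
    -- The relative latching map at `n` sees only degrees up to `n`, where stage `n` already agrees
    -- with the colimit.
    rw [← colimit.w F (homOfLE (Nat.zero_le n.len))]
    exact hasLiftingProperty_relativeLatchingMap_comp _ _ _ _
      (hasLiftingProperty_matchingTowerFunctor_map P n.len n q hq)
      (hasLiftingProperty_relativeLatchingMap_of_isIso _ _ _ fun m hm ↦ hι _ m hm)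
  · refine MatchingLifts.of_isIso (colimit.ι F n.len) (fun m hm ↦ hι _ m hm) ?_
    obtain ⟨⟨⟩ | k⟩ := n
    · exact absurd hn (lt_irrefl 0)
    · exact matchingLifts_attach_matchingCell (matchingTower P k) ⦋k + 1⦌

end

/-! ### Pushouts of Reedy cofibrations -/

section

variable {C : Type u} [Category.{v} C] [HasFiniteColimits C]

/-- The problem is restricted to `g`, solved there, and the solution is glued to `u` by the
universal property of the pushout in degree `n`. -/
lemma hasLiftingProperty_relativeLatchingMap_of_isPushout {A B D Q : SimplexCategory ⥤ C}
    {f : A ⟶ B} {g : A ⟶ D} {inl : B ⟶ Q} {inr : D ⟶ Q} (h : IsPushout f g inl inr)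
    (n : SimplexCategory) {E S : C} (q : E ⟶ S)
    (hg : HasLiftingProperty (relativeLatchingMap g n) q) :
    HasLiftingProperty (relativeLatchingMap inl n) q := by
  have hn (m : SimplexCategory) : IsPushout (f.app m) (g.app m) (inl.app m) (inr.app m) :=
    h.map ((evaluation _ _).obj m)
  rw [hasLiftingProperty_relativeLatchingMap_iff] at hg ⊢
  intro u w z h₁ h₂ h₃
  obtain ⟨l, hl₁, hl₂, hl₃⟩ := hg (f.app n ≫ u) (latchingObjMap inr n ≫ w) (inr.app n ≫ z)
    (by
      rw [← latchingObjMap_comp_assoc, ← h.w, latchingObjMap_comp_assoc, h₁, ← Category.assoc,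
        latchingObjMap_comp_latchingMap, Category.assoc])
    (by
      rw [← Category.assoc, ← latchingObjMap_comp_latchingMap, Category.assoc, h₂,
        Category.assoc])
    (by rw [Category.assoc, ← h₃, ← (hn n).w_assoc])
  refine ⟨(hn n).desc u l hl₂.symm, ?_, (hn n).inl_desc _ _ _, ?_⟩
  · refine latchingObj_hom_ext fun j ↦ ?_
    rw [ι_latchingMap_assoc]
    apply (hn j.obj.left).hom_ext
    · rw [← inl.naturality_assoc, IsPushout.inl_desc, ← ι_latchingObjMap_assoc, h₁,
        ι_latchingMap_assoc]
    · rw [← inr.naturality_assoc, IsPushout.inr_desc, ← ι_latchingObjMap_assoc, ← hl₁,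
        ι_latchingMap_assoc]
  · apply (hn n).hom_ext
    · rw [IsPushout.inl_desc_assoc, h₃]
    · rw [IsPushout.inr_desc_assoc, hl₃]

end

section

variable {C : Type u} [Category.{v} C] [ModelCategory C]

lemma IsReedyCofibration.of_isPushout {A B D Q : SimplexCategory ⥤ C}
    {f : A ⟶ B} {g : A ⟶ D} {inl : B ⟶ Q} {inr : D ⟶ Q} (h : IsPushout f g inl inr)
    (hg : IsReedyCofibration g) : IsReedyCofibration inl := by
  rw [isReedyCofibration_iff] at hg ⊢
  exact fun n _ _ q hq ↦ hasLiftingProperty_relativeLatchingMap_of_isPushout h n q (hg n q hq)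

/-- A Reedy cofibration is a cofibration in degree zero. -/
lemma IsReedyCofibration.cofibration_app_zero {A B : SimplexCategory ⥤ C} {f : A ⟶ B}
    (hf : IsReedyCofibration f) : Cofibration (f.app ⦋0⦌) := by
  rw [isReedyCofibration_iff] at hf
  rw [cofibration_iff, ← trivialFibrations_llp]
  intro E S q hq
  have hlift := hf ⦋0⦌ q hq
  rw [hasLiftingProperty_relativeLatchingMap_iff] at hlift
  -- The latching category at zero is empty, so the latching data impose no condition.
  have he (j : LatchingCategory ⦋0⦌) : False := Nat.not_lt_zero _ j.len_lt
  refine ⟨fun {u z} sq ↦ ?_⟩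
  obtain ⟨l, -, hl₂, hl₃⟩ := hlift u (latchingDesc (fun j ↦ (he j).elim) fun j ↦ (he j).elim) z
    (latchingObj_hom_ext fun j ↦ (he j).elim) (latchingObj_hom_ext fun j ↦ (he j).elim) sq.w.symm
  exact ⟨⟨⟨l, hl₂, hl₃⟩⟩⟩

/-! ### Invariance in the cosimplicial variable -/

/-- The relative latching maps are trivial cofibrations, so maps to the fibrant object `Z` extend
along them. -/
lemma isWeakEquivalence_mappingSpaceMapLeft {A B : SimplexCategory ⥤ C} (f : A ⟶ B)
    (hf : IsReedyCofibration f) (hf' : ∀ n, WeakEquivalence (f.app n)) (Z : C) [IsFibrant Z] :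
    IsWeakEquivalence (mappingSpaceMapLeft f Z) := by
  refine isWeakEquivalence_of_rlp _ (rlp_mappingSpaceMapLeft f Z fun n u w h ↦ ?_)
  have := hf n
  have := weakEquivalence_relativeLatchingMap f hf hf' n
  have hlift : HasLiftingProperty (relativeLatchingMap f n) (terminal.from Z) := inferInstance
  rw [hasLiftingProperty_relativeLatchingMap_iff] at hlift
  obtain ⟨l, h₁, h₂, -⟩ := hlift u w (terminal.from _) h (Subsingleton.elim _ _)
    (Subsingleton.elim _ _)
  exact ⟨l, h₁, h₂⟩

/-- In positive degrees the map is even a trivial fibration: `W` is homotopically constant. -/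
lemma weakEquivalence_map_of_matchingLifts {W : SimplexCategory ⥤ C}
    (hW : ∀ n : SimplexCategory, 0 < n.len → MatchingLifts W n) (n : SimplexCategory)
    (t : n ⟶ ⦋0⦌) : WeakEquivalence (W.map t) := by
  obtain ⟨⟨⟩ | k⟩ := n
  · obtain rfl : t = 𝟙 _ := Subsingleton.elim _ _
    infer_instance
  · have h : trivialFibrations C (W.map t) := by
      rw [← cofibrations_rlp]
      intro K L i hi
      rw [← cofibration_iff] at hi
      exact hasLiftingProperty_map_of_matchingLifts hW _ (Nat.succ_pos k) t i
    exact ((mem_trivialFibrations_iff _).1 h).2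

/-! ### Comparison of two frames through a common enlargement -/

namespace CosimplicialFrame

variable {X : C}

lemma weakEquivalence_map (F : CosimplicialFrame X) {n m : SimplexCategory} (t : n ⟶ m) :
    WeakEquivalence (F.obj.map t) := by
  have := F.weakEquivalence_π n
  have := F.weakEquivalence_π m
  have h : F.obj.map t ≫ F.π.app m = F.π.app n :=
    (F.π.naturality t).trans (Category.comp_id _)
  exact weakEquivalence_of_postcomp_of_fac h

instance isIso_foldMap_app_zero : IsIso ((foldMap X).app ⦋0⦌) := by
  refine ⟨Sigma.ι (fun _ : Fin 1 ↦ X) 0, ?_, ?_⟩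
  · refine Sigma.hom_ext _ _ fun (i : Fin 1) ↦ ?_
    obtain rfl : i = 0 := Subsingleton.elim _ _
    refine (Sigma.ι_desc_assoc _ _ _).trans ?_
    exact (Category.id_comp _).trans (Category.comp_id _).symm
  · exact Sigma.ι_desc (fun _ : Fin 1 ↦ 𝟙 X) 0

lemma weakEquivalence_ι_app_zero (F : CosimplicialFrame X) :
    WeakEquivalence (F.ι.app ⦋0⦌) := by
  have := F.weakEquivalence_π ⦋0⦌
  have h : F.ι.app ⦋0⦌ ≫ F.π.app ⦋0⦌ = (foldMap X).app ⦋0⦌ := by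
    rw [← NatTrans.comp_app, F.fac]
  exact weakEquivalence_of_postcomp_of_fac h

/-- In degree zero the fold map is an isomorphism, so `G.ι` is a trivial cofibration there and `inl`
is its cobase change. In higher degrees this argument fails, which is why the pushout has to be
enlarged. -/
lemma weakEquivalence_app_of_isPushout (F G : CosimplicialFrame X) {Q : SimplexCategory ⥤ C}
    {inl : F.obj ⟶ Q} {inr : G.obj ⟶ Q} (h : IsPushout F.ι G.ι inl inr) :
    WeakEquivalence (inl.app ⦋0⦌) := by
  have := G.weakEquivalence_ι_app_zero
  have := G.isReedyCofibration_ι.cofibration_app_zero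
  have h₀ : IsPushout (F.ι.app ⦋0⦌) (G.ι.app ⦋0⦌) (inl.app ⦋0⦌) (inr.app ⦋0⦌) :=
    h.map ((evaluation _ _).obj ⦋0⦌)
  have h' : trivialCofibrations C (inl.app ⦋0⦌) :=
    MorphismProperty.of_isPushout h₀ (mem_trivialCofibrations (G.ι.app ⦋0⦌))
  exact ((mem_trivialCofibrations_iff _).1 h').2

/-- The map from a frame to a common enlargement of two frames induces weak equivalences of
mapping spaces. -/
lemma isWeakEquivalence_of_isPushout (F G : CosimplicialFrame X) {Q W : SimplexCategory ⥤ C}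
    {inl : F.obj ⟶ Q} {inr : G.obj ⟶ Q} (h : IsPushout F.ι G.ι inl inr) (j : Q ⟶ W)
    (hj : IsReedyCofibration j) (hj₀ : IsIso (j.app ⦋0⦌))
    (hW : ∀ n : SimplexCategory, 0 < n.len → MatchingLifts W n) (Z : C) [IsFibrant Z] :
    IsWeakEquivalence (mappingSpaceMapLeft (inl ≫ j) Z) := by
  refine isWeakEquivalence_mappingSpaceMapLeft _
    ((IsReedyCofibration.of_isPushout h G.isReedyCofibration_ι).comp hj) (fun n ↦ ?_) Z
  let t : n ⟶ ⦋0⦌ := SimplexCategory.const n ⦋0⦌ 0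
  have := F.weakEquivalence_map t
  have := weakEquivalence_map_of_matchingLifts hW n t
  have := F.weakEquivalence_app_of_isPushout G h
  -- The square comparing degree `n` with degree zero has weak equivalences on its other three
  -- sides.
  have fac : (inl ≫ j).app n ≫ W.map t = F.obj.map t ≫ inl.app ⦋0⦌ ≫ j.app ⦋0⦌ := by
    rw [← NatTrans.naturality, NatTrans.comp_app]
  exact weakEquivalence_of_postcomp_of_fac fac

theorem weaklyEquivalent_mappingSpace (F G : CosimplicialFrame X) (Z : C) [IsFibrant Z] :
    WeaklyEquivalent (mappingSpace F.obj Z) (mappingSpace G.obj Z) := by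
  obtain ⟨W, j, hj, hj₀, hW⟩ := exists_isReedyCofibration_matchingLifts (pushout F.ι G.ι)
  have h := IsPushout.of_hasPushout F.ι G.ι
  exact .trans _ (mappingSpace W Z) _
    (.symm _ _ (.rel _ _ ⟨_, F.isWeakEquivalence_of_isPushout G h j hj hj₀ hW Z⟩))
    (.rel _ _ ⟨_, G.isWeakEquivalence_of_isPushout F h.flip j hj hj₀ hW Z⟩)

end CosimplicialFrame

/-! ### Invariance in the target -/

/-- The cosimplicial object `ℓ•X` is Reedy cofibrant if `X` is cofibrant. -/
lemma hasLiftingProperty_latchingMap_lObj {X : C} (hX : IsCofibrant X) (n : SimplexCategory)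
    {E S : C} (q : E ⟶ S) (hq : trivialFibrations C q) :
    HasLiftingProperty (latchingMap (lObj X) n) q := by
  refine ⟨fun {u z} sq ↦ ?_⟩
  let inj (m : SimplexCategory) (b : Fin (m.len + 1)) : X ⟶ (lObj X).obj m :=
    Sigma.ι (fun _ : Fin (m.len + 1) ↦ X) b
  have inj_map {m k : SimplexCategory} (b : Fin (m.len + 1)) (f : m ⟶ k) :
      inj m b ≫ (lObj X).map f = inj k (SimplexCategory.Hom.toOrderHom f b) :=
    (Sigma.ι_comp_map' _ _ _).trans (Category.id_comp _)
  have ex (a : Fin (n.len + 1)) : ∃ l : X ⟶ E, l ≫ q = inj n a ≫ z ∧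
      ∀ (j : LatchingCategory n) (b : Fin (j.obj.left.len + 1)),
        SimplexCategory.Hom.toOrderHom j.obj.hom b = a → l = inj _ b ≫ latchingι _ j ≫ u := by
    -- In positive degrees each vertex is a proper face, so the lift on its copy of `X` is forced by
    -- `u`. Only degree zero calls on the cofibrancy of `X`.
    by_cases hn : 0 < n.len
    · let c : ⦋0⦌ ⟶ n := SimplexCategory.const ⦋0⦌ n a
      have hc : Mono c := SimplexCategory.mono_iff_injective.2
        (Function.injective_of_subsingleton (α := Fin 1) _)
      let jc : LatchingCategory n := ⟨Over.mk c, hc, hn⟩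
      refine ⟨inj _ (0 : Fin 1) ≫ latchingι _ jc ≫ u, ?_, fun j b hb ↦ ?_⟩
      · rw [Category.assoc, Category.assoc, sq.w, ι_latchingMap_assoc, ← Category.assoc, inj_map]
        rfl
      · let f : jc ⟶ j := ObjectProperty.homMk
          (Over.homMk (SimplexCategory.const ⦋0⦌ j.obj.left b) (by
            refine (SimplexCategory.const_comp _ _ _).trans ?_
            exact congrArg (SimplexCategory.const ⦋0⦌ n) hb))
        rw [← latchingι_w_assoc (lObj X) f, ← Category.assoc, inj_map]
        rfl
    · rw [mem_trivialFibrations_iff] at hq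
      obtain ⟨_, _⟩ := hq
      have sq' : CommSq (initial.to E) (initial.to X) q (inj n a ≫ z) := ⟨Subsingleton.elim _ _⟩
      exact ⟨sq'.lift, sq'.fac_right, fun j ↦ absurd (Nat.zero_lt_of_lt j.len_lt) hn⟩
  choose l hl₁ hl₂ using ex
  let d : (lObj X).obj n ⟶ E := Sigma.desc l
  refine ⟨⟨⟨d, ?_, ?_⟩⟩⟩
  · refine latchingObj_hom_ext fun j ↦ ?_
    rw [ι_latchingMap_assoc]
    refine Sigma.hom_ext _ _ fun b ↦ ?_
    change inj _ b ≫ (lObj X).map _ ≫ d = inj _ b ≫ _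
    rw [← Category.assoc, inj_map]
    exact (Sigma.ι_desc _ _).trans (hl₂ _ j b rfl)
  · refine Sigma.hom_ext _ _ fun a ↦ ?_
    exact (Sigma.ι_desc_assoc _ _ _).trans (hl₁ a)

/-- The latching map of `B` is a cobase change of that of `A` followed by the relative latching map.
-/
lemma hasLiftingProperty_latchingMap_of_relative {C : Type u} [Category.{v} C]
    [HasFiniteColimits C] {A B : SimplexCategory ⥤ C} (f : A ⟶ B)
    (n : SimplexCategory) {E S : C} (q : E ⟶ S) (hA : HasLiftingProperty (latchingMap A n) q)
    (hf : HasLiftingProperty (relativeLatchingMap f n) q) :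
    HasLiftingProperty (latchingMap B n) q := by
  rw [hasLiftingProperty_relativeLatchingMap_iff] at hf
  refine ⟨fun {w z} sq ↦ ?_⟩
  have sq' : CommSq (latchingObjMap f n ≫ w) (latchingMap A n) q (f.app n ≫ z) := ⟨by
    rw [Category.assoc, sq.w, ← Category.assoc, latchingObjMap_comp_latchingMap, Category.assoc]⟩
  obtain ⟨l, h₁, -, h₃⟩ := hf sq'.lift w z sq'.fac_left.symm sq.w.symm sq'.fac_right.symm
  exact ⟨⟨⟨l, h₁, h₃⟩⟩⟩

lemma CosimplicialFrame.isWeakEquivalence_mappingSpaceMapRight {X : C} (hX : IsCofibrant X)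
    (F : CosimplicialFrame X) {T Z : C} (q : T ⟶ Z) (hq : trivialFibrations C q) :
    IsWeakEquivalence (mappingSpaceMapRight F.obj q) :=
  isWeakEquivalence_of_rlp _ (rlp_mappingSpaceMapRight F.obj q fun n ↦
    hasLiftingProperty_latchingMap_of_relative F.ι n q
      (hasLiftingProperty_latchingMap_lObj hX n q hq)
      ((isReedyCofibration_iff _).1 F.isReedyCofibration_ι n q hq))

/-- Two fibrant replacements are dominated by a third one by trivial fibrations. -/
lemma FibrantReplacement.exists_trivialFibrations {Y : C} (Y₁ Y₂ : FibrantReplacement Y) :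
    ∃ (T : C) (q₁ : T ⟶ Y₁.obj) (q₂ : T ⟶ Y₂.obj),
      trivialFibrations C q₁ ∧ trivialFibrations C q₂ := by
  have := Y₁.isFibrant
  have := Y₂.isFibrant
  have := Y₁.weakEquivalence_ι
  have := Y₂.weakEquivalence_ι
  -- Projections from a product of fibrant objects are fibrations, so the composites from `h.Z` are
  -- too; two-out-of-three under `Y` makes them weak equivalences.
  let h := MorphismProperty.factorizationData (trivialCofibrations C) (fibrations C)
    (prod.lift Y₁.ι Y₂.ι)
  have fac₁ : h.i ≫ h.p ≫ prod.fst = Y₁.ι := by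
    rw [h.fac_assoc, prod.lift_fst]
  have fac₂ : h.i ≫ h.p ≫ prod.snd = Y₂.ι := by
    rw [h.fac_assoc, prod.lift_snd]
  have := weakEquivalence_of_precomp_of_fac fac₁
  have := weakEquivalence_of_precomp_of_fac fac₂
  exact ⟨h.Z, h.p ≫ prod.fst, h.p ≫ prod.snd, mem_trivialFibrations _, mem_trivialFibrations _⟩

end

end Framings

end

/-! ### The comparison of mapping spaces -/

theorem mainTheorem7 {C : Type u} [Category.{v} C] [ModelCategory C] (X Y : C)
    (hX : IsCofibrant X) (X₁ X₂ : Framings.CosimplicialFrame X)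
    (Y₁ Y₂ : Framings.FibrantReplacement Y) :
    Framings.WeaklyEquivalent
      (Framings.mappingSpace X₁.obj Y₁.obj) (Framings.mappingSpace X₂.obj Y₂.obj) := by
  obtain ⟨T, q₁, q₂, hq₁, hq₂⟩ := Y₁.exists_trivialFibrations Y₂
  have := Y₂.isFibrant
  -- The target is changed first, with the frame `X₁` fixed; the frame is changed afterwards, over
  -- the fibrant object `Y₂.obj`.
  exact .trans _ (Framings.mappingSpace X₁.obj Y₂.obj) _
    (.trans _ (Framings.mappingSpace X₁.obj T) _
      (.symm _ _ (.rel _ _ ⟨_, X₁.isWeakEquivalence_mappingSpaceMapRight hX q₁ hq₁⟩))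
      (.rel _ _ ⟨_, X₁.isWeakEquivalence_mappingSpaceMapRight hX q₂ hq₂⟩))
    (X₁.weaklyEquivalent_mappingSpace X₂ Y₂.obj)
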